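/- **Setting.** Let $n\ge 1$, $d\ge 0$, $M\ge 0$, $R>0$, $\epsilon>0$, $\chi\ge 1$. Let $f_1,\dots,f_n:\mathbb{R}^d\to\mathbb{R}$ be convex and $M$-Lipschitz (Euclidean norm), let $\hat\nabla f_i:\mathbb{R}^d\to\mathbb{R}^d$ satisfy $\hat\nabla f_i(x)\in\partial f_i(x)$ for all $x$, and suppose that $\bar f=\frac1n\sum_{i=1}^n f_i$ has a minimizer $x^*$ with $\|x^*\|\le R$. Let $\mathcal{E}(\tau)\subset\{1,\dots,n\}^2$ $(\tau\ge 0)$ be the edges of a time-varying network, and let $\mathbf{W}(\tau)\in\mathbb{R}^{n\times n}$ be gossip matrices: for all $\tau\ge0$, $\mathbf{W}(\tau)_{ij}=0$ if $i\ne j$ and $(j,i)\notin\mathcal{E}(\tau)$; $\mathbf{W}(\tau)\mathbf{1}=0$ and $\mathbf{W}(\tau)^\top\mathbf{1}=0$; and $\|\mathbf{W}(\tau)x-x\|^2\le(1-1/\chi)\|x\|^2$ for all $x\in\mathbb{R}^n$ with $\sum_i x_i=0$. **Algorithm 1**, for $r>0$ and integers $K,T\ge1$. Put $r_x=\frac23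 r$, $r_{yz}=3/r$, $\alpha_k=\frac{3}{k+3}$, $\gamma_k=\frac{k+2}{k+3}$, $\tau_x^k=\frac{r_x}{2\alpha_k}$, $\eta_y^k=\frac{1}{4r_{yz}\alpha_k}$, $\eta_z^k=\frac{1}{10r_{yz}\chi^2\alpha_k}$, $\theta=\frac1{2r_{yz}}$, $\eta_x^k=\frac1{\tau_x^kT}$, $\sigma_k=\frac{\tau_x^k}{2\tau_x^k+r_x}$, $\lambda_K=\alpha_{K-1}^{-2}$, and $\lambda_k=\alpha_{k-1}^{-2}+\alpha_k^{-1}-\alpha_k^{-2}$ for $1\le k<K$. The variables lie in $(\mathbb{R}^d)^n$ (the $i$-th block is held by node $i$), and $x^0,x^{-1},\tilde x^0,\bar x^0,y^0,\bar y^0,z^0,\bar z^0,m^0$ are all $0$. For $k=0,\dots,K-1$: 1. $\underline y^k=\alpha_ky^k+(1-\alpha_k)\bar y^k$, $\ \underline z^k=\alpha_kz^k+(1-\alpha_k)\bar z^k$, $\ g_y^k=g_z^k=r_{yz}(\underline y^k+\underline z^k)$ (the partial gradients of $G(y,z)=\frac{r_{yz}}2\|y+z\|^2$); 2. one decentralized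 communication: $\tilde g_z^k=(\mathbf{W}_k\otimes\mathbf{I}_d)g_z^k$ and $\hat g_z^k=(\mathbf{W}_k\otimes\mathbf{I}_d)(g_z^k+m^k)$, where $\mathbf{W}_k=\mathbf{W}(\tau_k)$ is the gossip matrix at the current time $\tau_k$; 3. $\hat x^{k+1}=x^k+\gamma_k(\tilde x^k-x^{k-1})$, $\ y^{k+1}=y^k-\eta_y^k(g_y^k+\hat x^{k+1})$, $\ z^{k+1}=z^k-\eta_z^k\hat g_z^k$, $\ \bar y^{k+1}=\underline y^k+\alpha_k(y^{k+1}-y^k)$, $\ \bar z^{k+1}=\underline z^k-\theta\tilde g_z^k$, $\ m^{k+1}=(\eta_z^k/\eta_z^{k+1})(m^k+g_z^k-\hat g_z^k)$; 4. $x^{k,0}=x^k$ and, for $t=0,\dots,T-1$, with one subgradient computation per node, $g_x^{k,t}=(\hat\nabla f_1(x_1^{k,t}),\dots,\hat\nabla f_n(x_n^{k,t}))$ and $x^{k,t+1}=x^{k,t}-\eta_x^k\bigl(g_x^{k,t}+r_xx^{k,t+1}-y^{k+1}+\tau_x^k(x^{k,t+1}-x^k)\bigr)$ (an equation that is solved for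 $x^{k,t+1}$); 5. $\tilde x^{k+1}=\frac1T\sum_{t=1}^Tx^{k,t}$, $\ x^{k+1}=\sigma_kx^{k,T}+(1-\sigma_k)\tilde x^{k+1}$, $\ \bar x^{k+1}=\alpha_k\tilde x^{k+1}+(1-\alpha_k)\bar x^k$. The output is $x_o^K=\frac1n\sum_{i=1}^nx^K_{a,i}$, where $x_a^K=\bigl(\sum_{k=1}^K\lambda_k\bigr)^{-1}\sum_{k=1}^K\lambda_k\bar x^k$. **Theorem.** Algorithm 1 with $r=\epsilon/R^2$ reaches the precision $\bar f(x_o^K)-\bar f(x^*)\le\epsilon$ after $K=O\!\left(\frac{\chi MR}{\epsilon}\right)$ decentralized communications and $K\times T=O\!\left(\frac{M^2R^2}{\epsilon^2}\right)$ subgradient computations (per node), where $K$ and $T$ are rounded up to positive integers. Precisely: there is a universal constant $C>0$ such that for all $M\ge0$, $R,\epsilon>0$, $\chi\ge1$ there are integers $K,T\ge1$, depending only on $M,R,\epsilon,\chi$, with $$K\le C\,\frac{\chi MR}{\epsilon}+1,\qquad KT\le C\,\frac{M^2R^2}{\epsilon^2}+K,$$ and, if $\chi\epsilon\le MR$, even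 with $K\le C\frac{\chi MR}{\epsilon}$ and $KT\le C\frac{M^2R^2}{\epsilon^2}$, such that the following holds for all $n,d,f_i,\hat\nabla f_i,x^*,\mathcal{E},\mathbf{W}$ as above and all times $\tau_k\ge 0$. For all integers $K',T'$ with $K'\ge K$ and $K'T'\ge KT$, Algorithm 1 with $r=\epsilon/R^2$, $K'$ outer and $T'$ inner iterations uses exactly $K'$ communications and $K'T'$ subgradient computations per node, and $\bar f(x_o^{K'})-\bar f(x^*)\le\epsilon$. -/

import Mathlib

open scoped NNReal

/-- The space `(ℝ^d)^n` with its Euclidean structure; the block `x i ∈ ℝ^d` is stored at node `i`. -/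
abbrev Nodes (n d : ℕ) : Type := PiLp 2 (fun _ : Fin n => EuclideanSpace ℝ (Fin d))

noncomputable section

/-! ### The optimization problem -/

/-- The objective `p(x) = (1/n) ∑ᵢ fᵢ(x) + (r/2) ‖x‖²`. -/
def objective {n d : ℕ} (f : Fin n → EuclideanSpace ℝ (Fin d) → ℝ) (r : ℝ)
    (x : EuclideanSpace ℝ (Fin d)) : ℝ :=
  (1 / (n : ℝ)) * ∑ i, f i x + r / 2 * ‖x‖ ^ 2

/-- `oracle i` selects a subgradient of `f i` at every point. -/
def IsSubgradientOracle {n d : ℕ} (f : Fin n → EuclideanSpace ℝ (Fin d) → ℝ)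
    (oracle : Fin n → EuclideanSpace ℝ (Fin d) → EuclideanSpace ℝ (Fin d)) : Prop :=
  ∀ i x u, f i x + inner ℝ (oracle i x) (u - x) ≤ f i u

/-! ### The time-varying network -/

/-- `W τ` is a gossip matrix of the directed graph with edge set `E τ`, at every time `τ ≥ 0`. -/
def IsGossip {n : ℕ} (E : ℝ≥0 → Set (Fin n × Fin n))
    (W : ℝ≥0 → Matrix (Fin n) (Fin n) ℝ) : Prop :=
  ∀ τ, (∀ i j, i ≠ j → (j, i) ∉ E τ → W τ i j = 0) ∧
    (W τ).mulVec (fun _ => 1) = 0 ∧ (W τ).transpose.mulVec (fun _ => 1) = 0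

/-- The network has condition number (at most) `χ`:
`‖W(τ) x - x‖² ≤ (1 - 1/χ) ‖x‖²` for all `τ ≥ 0` and all `x ∈ ℝ^n` whose entries sum to zero. -/
def HasConditionNumber {n : ℕ} (W : ℝ≥0 → Matrix (Fin n) (Fin n) ℝ) (χ : ℝ) : Prop :=
  ∀ τ, ∀ x : Fin n → ℝ, ∑ i, x i = 0 →
    ‖WithLp.toLp 2 ((W τ).mulVec x - x)‖ ^ 2 ≤ (1 - 1 / χ) * ‖WithLp.toLp 2 x‖ ^ 2

/-- The product `(A ⊗ I_d) g`. -/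
def gossip {n d : ℕ} (A : Matrix (Fin n) (Fin n) ℝ) (g : Nodes n d) : Nodes n d :=
  WithLp.toLp 2 (fun i => ∑ j, A i j • g j)

/-! ### The algorithm -/

/-- `G(y, z) = (r_yz / 2) ‖y + z‖²`. -/
def coupling {n d : ℕ} (ryz : ℝ) (y z : Nodes n d) : ℝ := ryz / 2 * ‖y + z‖ ^ 2

/-- The partial gradient `∇_y G(y, z)`. -/
def gradY {n d : ℕ} (ryz : ℝ) (y z : Nodes n d) : Nodes n d := ryz • (y + z)

/-- The partial gradient `∇_z G(y, z)`. -/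
def gradZ {n d : ℕ} (ryz : ℝ) (y z : Nodes n d) : Nodes n d := ryz • (y + z)

theorem hasGradientAt_coupling_y {n d : ℕ} (ryz : ℝ) (y z : Nodes n d) :
    HasGradientAt (fun u => coupling ryz u z) (gradY ryz y z) y := by
  rw [hasGradientAt_iff_hasFDerivAt]
  have h := (((hasFDerivAt_id (𝕜 := ℝ) y).add_const z).norm_sq).const_mul (ryz / 2)
  refine h.congr_fderiv ?_
  ext v
  simp [gradY]
  ring

theorem hasGradientAt_coupling_z {n d : ℕ} (ryz : ℝ) (y z : Nodes n d) :
    HasGradientAt (fun u => coupling ryz y u) (gradZ ryz y z) z := by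
  rw [hasGradientAt_iff_hasFDerivAt]
  have h := (((hasFDerivAt_id (𝕜 := ℝ) z).const_add y).norm_sq).const_mul (ryz / 2)
  refine h.congr_fderiv ?_
  ext v
  simp [gradZ]
  ring

/-- The parameters of the algorithm. -/
structure AlgParams where
  ryz : ℝ
  α : ℕ → ℝ
  β : ℕ → ℝ
  γ : ℕ → ℝ
  σ : ℕ → ℝ
  lam : ℕ → ℝ
  τx : ℕ → ℝ
  ηx : ℕ → ℝ
  ηy : ℕ → ℝ
  ηz : ℕ → ℝ
  θz : ℕ → ℝ

/-- The variables of the algorithm at the beginning of iteration `k`: `x^k`, `x^{k-1}`, `x̃^k`,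
`x̄^k`, `y^k`, `ȳ^k`, `z^k`, `z̄^k`, `m^k`, together with two counters: the number of rounds of
decentralized communication performed so far, and the number of subgradients that
each node has computed so far. -/
structure AlgState (n d : ℕ) where
  x : Nodes n d
  xPrev : Nodes n d
  xTilde : Nodes n d
  xBar : Nodes n d
  y : Nodes n d
  yBar : Nodes n d
  z : Nodes n d
  zBar : Nodes n d
  m : Nodes n d
  comms : ℕ
  subgrads : ℕ

/-- One inner step: the solution `u = x^{k,t+1}` of
`u = v - η (g + β u - y + τ (u - x))`, where `v = x^{k,t}` and `gᵢ = oracle i vᵢ`. -/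
def innerStep {n d : ℕ}
    (oracle : Fin n → EuclideanSpace ℝ (Fin d) → EuclideanSpace ℝ (Fin d))
    (η β τ : ℝ) (y x v : Nodes n d) : Nodes n d :=
  let g : Nodes n d := WithLp.toLp 2 (fun i => oracle i (v i))
  (1 + η * (β + τ))⁻¹ • (v - η • (g - y - τ • x))

theorem innerStep_iff {n d : ℕ}
    (oracle : Fin n → EuclideanSpace ℝ (Fin d) → EuclideanSpace ℝ (Fin d))
    (η β τ : ℝ) (y x v u : Nodes n d) (h : 0 < 1 + η * (β + τ)) :
    u = innerStep oracle η β τ y x v ↔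
      u = v - η • (WithLp.toLp 2 (fun i => oracle i (v i)) + β • u - y + τ • (u - x)) := by
  unfold innerStep
  rw [eq_inv_smul_iff₀ h.ne', ← sub_eq_zero]
  conv_rhs => rw [← sub_eq_zero]
  generalize WithLp.toLp 2 (fun i => oracle i (v i)) = g
  rw [show (1 + η * (β + τ)) • u - (v - η • (g - y - τ • x)) =
    u - (v - η • (g + β • u - y + τ • (u - x))) by module]

/-- The inner loop started at `x^{k,0} = x`: the pair of `x^{k,t}` and
the number of subgradients computed by each node, which grows by one in every inner step. -/
def innerLoop {n d : ℕ}
    (oracle : Fin n → EuclideanSpace ℝ (Fin d) → EuclideanSpace ℝ (Fin d))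
    (η β τ : ℝ) (y x : Nodes n d) (count : ℕ) : ℕ → Nodes n d × ℕ
  | 0 => (x, count)
  | t + 1 =>
    let q := innerLoop oracle η β τ y x count t
    (innerStep oracle η β τ y x q.1, q.2 + 1)

/-- Iteration `k` of the outer loop, with gossip matrix `A = W_k` and `T` inner steps. Both products
with `A` belong to the same round of communication. -/
def outerStep {n d : ℕ} (P : AlgParams)
    (oracle : Fin n → EuclideanSpace ℝ (Fin d) → EuclideanSpace ℝ (Fin d))
    (A : Matrix (Fin n) (Fin n) ℝ) (T k : ℕ) (s : AlgState n d) : AlgState n d :=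
  let yLow := P.α k • s.y + (1 - P.α k) • s.yBar
  let zLow := P.α k • s.z + (1 - P.α k) • s.zBar
  let gy := gradY P.ryz yLow zLow
  let gz := gradZ P.ryz yLow zLow
  let gzTilde := gossip A gz
  let gzHat := gossip A (gz + s.m)
  let xHat := s.x + P.γ k • (s.xTilde - s.xPrev)
  let yNext := s.y - P.ηy k • (gy + xHat)
  let zNext := s.z - P.ηz k • gzHat
  let inn := innerLoop oracle (P.ηx k) (P.β k) (P.τx k) yNext s.x s.subgrads
  let xTildeNext := (1 / (T : ℝ)) • ∑ t ∈ Finset.Icc 1 T, (inn t).1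
  { x := P.σ k • (inn T).1 + (1 - P.σ k) • xTildeNext
    xPrev := s.x
    xTilde := xTildeNext
    xBar := P.α k • xTildeNext + (1 - P.α k) • s.xBar
    y := yNext
    yBar := yLow + P.α k • (yNext - s.y)
    z := zNext
    zBar := zLow - P.θz k • gzTilde
    m := (P.ηz k / P.ηz (k + 1)) • (s.m + gz - gzHat)
    comms := s.comms + 1
    subgrads := (inn T).2 }

/-- The state after `k` outer iterations, from the input `x⁰ = y⁰ = z⁰ = m⁰ = 0`
(with `x^{-1} = x̃⁰ = x̄⁰ = x⁰`, `ȳ⁰ = y⁰`, `z̄⁰ = z⁰`). -/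
def algState {n d : ℕ} (P : AlgParams)
    (oracle : Fin n → EuclideanSpace ℝ (Fin d) → EuclideanSpace ℝ (Fin d))
    (A : ℕ → Matrix (Fin n) (Fin n) ℝ) (T : ℕ) : ℕ → AlgState n d
  | 0 => ⟨0, 0, 0, 0, 0, 0, 0, 0, 0, 0, 0⟩
  | k + 1 => outerStep P oracle (A k) T k (algState P oracle A T k)

/-- The output after `K` outer iterations: the average over the nodes of
`x_a = (∑ₖ λₖ)⁻¹ ∑ₖ λₖ x̄^k`, where `k = 1, …, K`. -/
def algOutput {n d : ℕ} (P : AlgParams)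
    (oracle : Fin n → EuclideanSpace ℝ (Fin d) → EuclideanSpace ℝ (Fin d))
    (A : ℕ → Matrix (Fin n) (Fin n) ℝ) (K T : ℕ) : EuclideanSpace ℝ (Fin d) :=
  let xa : Nodes n d := (∑ k ∈ Finset.Icc 1 K, P.lam k)⁻¹ •
    ∑ k ∈ Finset.Icc 1 K, P.lam k • (algState P oracle A T k).xBar
  (1 / (n : ℝ)) • ∑ i, xa i

/-- The choice of the parameters, for the problem with regularization parameter `r > 0` over a
network with condition number `χ`, and for `K` outer and `T` inner iterations. -/
def algParams (r χ : ℝ) (K T : ℕ) : AlgParams :=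
  let rx : ℝ := 2 / 3 * r
  let ryz : ℝ := 3 / r
  let α : ℕ → ℝ := fun k => 3 / ((k : ℝ) + 3)
  let τx : ℕ → ℝ := fun k => rx / 2 * (α k)⁻¹
  { ryz := ryz
    α := α
    β := fun _ => rx
    γ := fun k => ((k : ℝ) + 2) / ((k : ℝ) + 3)
    σ := fun k => τx k / (2 * τx k + rx)
    lam := fun k =>
      if k = K then ((α (K - 1)) ^ 2)⁻¹
      else ((α (k - 1)) ^ 2)⁻¹ + (α k)⁻¹ - ((α k) ^ 2)⁻¹
    τx := τx
    ηx := fun k => 1 / (τx k * T)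
    ηy := fun k => (4 * ryz)⁻¹ * (α k)⁻¹
    ηz := fun k => (10 * ryz * χ ^ 2)⁻¹ * (α k)⁻¹
    θz := fun _ => 1 / (2 * ryz) }

end

/-!
The algorithm solves the saddle point problem `min_x max_{y, z} L(x, y, z)` on `(ℝ^d)^n`, with
`L(x, y, z) = ∑ᵢ fᵢ(xᵢ) + (r / 3) ‖x‖² - ⟪y, x⟫ - (3 / (2 r)) ‖y + z‖²` and `∑ᵢ zᵢ = 0`; maximizing
over `y` and `z` forces consensus and turns `L` into `∑ᵢ (fᵢ(x) + (r / 2) ‖x‖²)`.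

*Rate.* Let `cx` be the consensus vector of a minimizer, and `cy = -cz` the centered subgradients
at the output. A Lyapunov function (`potential`) decreases along the outer iterations up to the
subgradient error (`potential_step`, from the scalar bookkeeping of `saddle_step`). It combines
three estimates. The inner loop is a proximal subgradient method, with error of order `n M² / (τ T)`
(`proximal_subgradient_loop`). The steps in `y` and `z` are accelerated gradient steps on the
quadratic coupling, and a communication round gains a fraction `1 / χ` of the projected gradient
(`coupled_gradient_step`). The vector `m` is an error feedback: shifted by it, the `z`-iterates
are those of exact projected gradient steps, and the shift is paid for by the gain of the
communication rounds (`error_feedback_step`).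

*From the saddle gap to the objective.* Since the centered subgradients have norm at most
`√n M`, no bound on the output and no saddle point of `L` is needed: the weighted sum of the gaps
`L(x̄, cy, cz) - L(cx, ȳ, z̄)` dominates `n (f̄(x_o) - f̄(x*) - (r / 2) ‖x*‖²)` times the sum of the
weights (`saddleGap_lower_bound`). This gives the rate in `objective_gap_le`: with
`Λ = N (N + 5) / 6`, the optimality gap is at most `(r / 2) R²` plus
`((r / 3) R² + 21 χ² M² / r + 6 M² N / (r S)) / Λ`. For `r = ε / R²` the terms without `M` amount to
at most `5 ε / 6`, even for `N = 1`, and `N ≥ 40 χ M R / ε` and `N S ≥ 432 M² R² / ε²` make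
the terms with `M` at most `ε / 6`.
-/

open scoped NNReal

/-! ### Proximal subgradient, coupled gradient and error feedback steps -/

section Abstract

variable {H : Type*} [NormedAddCommGroup H] [InnerProductSpace ℝ H]

/-- Jensen's inequality for a uniform average, for a function with a subgradient at the average. -/
theorem jensen_average {h : H → ℝ} {s : H} {T : ℕ} (hT : 1 ≤ T) (u : ℕ → H)
    (hs : ∀ w, h ((1 / (T : ℝ)) • ∑ t ∈ Finset.range T, u t) +
      inner ℝ s (w - (1 / (T : ℝ)) • ∑ t ∈ Finset.range T, u t) ≤ h w) :
    T * h ((1 / (T : ℝ)) • ∑ t ∈ Finset.range T, u t) ≤ ∑ t ∈ Finset.range T, h (u t) := by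
  have hT0 : (T : ℝ) ≠ 0 := by positivity
  set m := (1 / (T : ℝ)) • ∑ t ∈ Finset.range T, u t with hm
  have h1 := Finset.sum_le_sum fun t (_ : t ∈ Finset.range T) => hs (u t)
  have h2 : ∑ t ∈ Finset.range T, (u t - m) = 0 := by
    rw [Finset.sum_sub_distrib, Finset.sum_const, Finset.card_range, ← Nat.cast_smul_eq_nsmul ℝ,
      hm, smul_smul, mul_one_div_cancel hT0, one_smul, sub_self]
  rw [Finset.sum_add_distrib, ← inner_sum, h2, inner_zero_right, Finset.sum_const,
    Finset.card_range, nsmul_eq_mul, add_zero] at h1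
  exact h1

theorem jensen_average_norm_sq {T : ℕ} (hT : 1 ≤ T) (u : ℕ → H) (c : H) :
    T * ‖(1 / (T : ℝ)) • ∑ t ∈ Finset.range T, u t - c‖ ^ 2 ≤
      ∑ t ∈ Finset.range T, ‖u t - c‖ ^ 2 := by
  refine jensen_average (h := fun w => ‖w - c‖ ^ 2)
    (s := (2 : ℝ) • ((1 / (T : ℝ)) • ∑ t ∈ Finset.range T, u t - c)) hT u fun w => ?_
  generalize (1 / (T : ℝ)) • ∑ t ∈ Finset.range T, u t = m
  have h1 := norm_add_sq_real (m - c) (w - m)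
  rw [show m - c + (w - m) = w - c by abel] at h1
  rw [real_inner_smul_left, h1]
  nlinarith [sq_nonneg ‖w - m‖]

theorem norm_sq_convex_combination {σ : ℝ} (h0 : 0 ≤ σ) (h1 : σ ≤ 1) (u v c : H) :
    ‖σ • u + (1 - σ) • v - c‖ ^ 2 ≤ σ * ‖u - c‖ ^ 2 + (1 - σ) * ‖v - c‖ ^ 2 := by
  have h2 := norm_add_sq_real (σ • (u - c)) ((1 - σ) • (v - c))
  have h3 := norm_sub_sq_real (u - c) (v - c)
  rw [show σ • (u - c) + (1 - σ) • (v - c) = σ • u + (1 - σ) • v - c by module,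
    norm_smul, norm_smul, real_inner_smul_left, real_inner_smul_right, mul_pow, mul_pow,
    Real.norm_eq_abs, Real.norm_eq_abs, sq_abs, sq_abs] at h2
  rw [h2]
  nlinarith [mul_nonneg (mul_nonneg h0 (sub_nonneg.2 h1)) (sq_nonneg ‖u - c - (v - c)‖)]

/-- A function with a subgradient at every point is convex. -/
theorem convex_combination_le_of_subgradient {F : H → ℝ} {s : H → H}
    (hs : ∀ v w, F v + inner ℝ (s v) (w - v) ≤ F w) {σ : ℝ} (h0 : 0 ≤ σ) (h1 : σ ≤ 1) (u v : H) :
    F (σ • u + (1 - σ) • v) ≤ σ * F u + (1 - σ) * F v := by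
  have hu := mul_le_mul_of_nonneg_left (hs (σ • u + (1 - σ) • v) u) h0
  have hv := mul_le_mul_of_nonneg_left (hs (σ • u + (1 - σ) • v) v) (sub_nonneg.2 h1)
  rw [show u - (σ • u + (1 - σ) • v) = (1 - σ) • (u - v) by module, real_inner_smul_right] at hu
  rw [show v - (σ • u + (1 - σ) • v) = -(σ • (u - v)) by module, inner_neg_right,
    real_inner_smul_right] at hv
  linarith

theorem two_inner_sub_sub (u v w : H) :
    2 * inner ℝ (u - v) (u - w) = ‖u - v‖ ^ 2 + ‖u - w‖ ^ 2 - ‖v - w‖ ^ 2 := by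
  have h := norm_sub_sq_real (u - w) (u - v)
  rw [show u - w - (u - v) = v - w by abel, real_inner_comm] at h
  linarith

/-- One proximal subgradient step: progress measured at the new point `u'`. -/
theorem proximal_subgradient_step {F : H → ℝ} {s : H → H} {B : ℝ}
    (hs : ∀ v w, F v + inner ℝ (s v) (w - v) ≤ F w) (hB : ∀ v, ‖s v‖ ≤ B)
    {η β τ : ℝ} (hη : 0 < η) {x y u u' : H}
    (hu : u' = u - η • (s u + β • u' - y + τ • (u' - x))) (c : H) :
    F u' + β / 2 * ‖u' - 0‖ ^ 2 + (β + τ) / 2 * ‖u' - c‖ ^ 2 + τ / 2 * ‖u' - x‖ ^ 2 - inner ℝ y u'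
      ≤ F c + β / 2 * ‖c‖ ^ 2 - inner ℝ y c + τ / 2 * ‖x - c‖ ^ 2
        + (2 * η)⁻¹ * (‖u - c‖ ^ 2 - ‖u' - c‖ ^ 2) + 2 * η * B ^ 2 := by
  have hs1 := hs u c
  have hs2 := hs u' u
  have key : s u = η⁻¹ • (u - u') - β • (u' - 0) + y - τ • (u' - x) := by
    have : u - u' = η • (s u + β • u' - y + τ • (u' - x)) :=
      sub_eq_iff_eq_add'.2 (eq_sub_iff_add_eq.1 hu).symm
    rw [this, inv_smul_smul₀ hη.ne']; simp; abel
  -- the error of evaluating the subgradient at the old point, by Young's inequality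
  have herr : inner ℝ (s u' - s u) (u' - u) ≤ 2 * η * B ^ 2 + (2 * η)⁻¹ * ‖u' - u‖ ^ 2 := by
    have h1 : inner ℝ (s u' - s u) (u' - u) ≤ 2 * B * ‖u' - u‖ := by
      refine (real_inner_le_norm _ _).trans ?_
      gcongr
      linarith [norm_sub_le (s u') (s u), hB u', hB u]
    have h2 : 2 * B * ‖u' - u‖ ≤ 2 * η * B ^ 2 + (2 * η)⁻¹ * ‖u' - u‖ ^ 2 := by
      have : 2 * η * B ^ 2 + (2 * η)⁻¹ * ‖u' - u‖ ^ 2 - 2 * B * ‖u' - u‖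
          = (2 * η)⁻¹ * (2 * η * B - ‖u' - u‖) ^ 2 := by field_simp; ring
      have : 0 ≤ (2 * η)⁻¹ * (2 * η * B - ‖u' - u‖) ^ 2 := by positivity
      linarith
    exact h1.trans h2
  have hi : inner ℝ (s u) (u' - c) = η⁻¹ * inner ℝ (u - u') (u' - c)
      - β * inner ℝ (u' - 0) (u' - c) + inner ℝ y (u' - c) - τ * inner ℝ (u' - x) (u' - c) := by
    rw [key]
    simp only [inner_add_left, inner_sub_left, real_inner_smul_left]
  have e1 := two_inner_sub_sub u' u c
  have e2 := two_inner_sub_sub u' 0 c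
  have e3 := two_inner_sub_sub u' x c
  rw [← neg_sub u' u, inner_neg_left] at hi
  have e4 : inner ℝ (s u) (c - u) = - inner ℝ (s u) (u' - c) + inner ℝ (s u) (u' - u) := by
    rw [← inner_neg_right, ← inner_add_right]; congr 1; abel
  have e5 : inner ℝ (s u') (u - u') = - inner ℝ (s u') (u' - u) := by
    rw [← inner_neg_right, neg_sub]
  rw [inner_sub_left] at herr
  rw [inner_sub_right y] at hi
  rw [zero_sub, norm_neg] at e2
  have e1' : inner ℝ (u' - u) (u' - c) = (‖u' - u‖ ^ 2 + ‖u' - c‖ ^ 2 - ‖u - c‖ ^ 2) / 2 := by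
    linarith
  have e2' : inner ℝ (u' - 0) (u' - c) = (‖u' - 0‖ ^ 2 + ‖u' - c‖ ^ 2 - ‖c‖ ^ 2) / 2 := by
    linarith
  have e3' : inner ℝ (u' - x) (u' - c) = (‖u' - x‖ ^ 2 + ‖u' - c‖ ^ 2 - ‖x - c‖ ^ 2) / 2 := by
    linarith
  rw [e1', e2', e3'] at hi
  rw [e4, hi] at hs1
  rw [e5] at hs2
  rw [mul_inv] at herr ⊢
  linarith

/-- The inner loop, run with step size `η = 1 / (τ T)`, averaged over its `T` iterates. -/
theorem proximal_subgradient_loop {F : H → ℝ} {s : H → H} {B : ℝ}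
    (hs : ∀ v w, F v + inner ℝ (s v) (w - v) ≤ F w) (hB : ∀ v, ‖s v‖ ≤ B)
    {β τ : ℝ} (hβ : 0 < β) (hτ : 0 < τ) {T : ℕ} (hT : 1 ≤ T) {x y : H} {u : ℕ → H} (hu0 : u 0 = x)
    (hu : ∀ t, u (t + 1) =
      u t - (1 / (τ * T)) • (s (u t) + β • u (t + 1) - y + τ • (u (t + 1) - x)))
    {xt x' : H} (hxt : xt = (1 / (T : ℝ)) • ∑ t ∈ Finset.range T, u (t + 1))
    (hx' : x' = (τ / (2 * τ + β)) • u T + (1 - τ / (2 * τ + β)) • xt) (c : H) :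
    F xt + β / 2 * ‖xt‖ ^ 2 - inner ℝ y xt + (τ + β / 2) * ‖x' - c‖ ^ 2 + τ / 2 * ‖xt - x‖ ^ 2
      ≤ F c + β / 2 * ‖c‖ ^ 2 - inner ℝ y c + τ * ‖x - c‖ ^ 2 + 2 * B ^ 2 / (τ * T) := by
  have hT0 : (0 : ℝ) < T := by positivity
  have hη : 0 < 1 / (τ * T) := by positivity
  have hstep := Finset.sum_le_sum fun t (_ : t ∈ Finset.range T) =>
    proximal_subgradient_step hs hB hη (hu t) c
  simp only [Finset.sum_add_distrib, Finset.sum_sub_distrib, Finset.sum_const, Finset.card_range,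
    ← Finset.mul_sum, nsmul_eq_mul] at hstep
  have htel := Finset.sum_range_sub' (fun t => ‖u t - c‖ ^ 2) T
  rw [Finset.sum_sub_distrib, hu0] at htel
  rw [htel, ← inner_sum] at hstep
  have j1 := jensen_average (h := F) hT (fun t => u (t + 1)) (hs _)
  have j2 := jensen_average_norm_sq hT (fun t => u (t + 1)) (0 : H)
  have j3 := jensen_average_norm_sq hT (fun t => u (t + 1)) c
  have j4 := jensen_average_norm_sq hT (fun t => u (t + 1)) x
  rw [← hxt] at j1 j2 j3 j4
  have hi : inner ℝ y (∑ t ∈ Finset.range T, u (t + 1)) = T * inner ℝ y xt := by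
    rw [hxt, real_inner_smul_right]; field_simp
  rw [hi] at hstep
  have hc : (2 * (1 / (τ * T)))⁻¹ = T * (τ / 2) := by field_simp
  rw [hc] at hstep
  have hσ0 : 0 ≤ τ / (2 * τ + β) := by positivity
  have hσ1 : τ / (2 * τ + β) ≤ 1 := by rw [div_le_one (by positivity)]; linarith
  have hcomb := norm_sq_convex_combination hσ0 hσ1 (u T) xt c
  rw [← hx'] at hcomb
  have hcomb' : (τ + β / 2) * ‖x' - c‖ ^ 2 ≤
      τ / 2 * ‖u T - c‖ ^ 2 + (β + τ) / 2 * ‖xt - c‖ ^ 2 := by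
    refine (mul_le_mul_of_nonneg_left hcomb (by positivity)).trans_eq ?_
    field_simp
    ring
  have k2 := mul_le_mul_of_nonneg_left j2 (show 0 ≤ β / 2 by positivity)
  have k3 := mul_le_mul_of_nonneg_left j3 (show 0 ≤ (β + τ) / 2 by positivity)
  have k4 := mul_le_mul_of_nonneg_left j4 (show 0 ≤ τ / 2 by positivity)
  rw [sub_zero] at k2
  have herr : (T : ℝ) * (2 * (1 / (τ * T)) * B ^ 2) = T * (2 * B ^ 2 / (τ * T)) := by ring
  rw [herr] at hstep
  refine le_of_mul_le_mul_left ?_ hT0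
  have hcT := mul_le_mul_of_nonneg_left hcomb' hT0.le
  linarith

/-- Potential decrease of the error feedback mechanism: `e` is the accumulated consensus error,
`p` the new gradient, and `e'` the part of `e + p` that the communication round fails to
transmit. -/
theorem error_feedback_step {χ : ℝ} (hχ : 1 ≤ χ) {e p e' : H}
    (he : ‖e'‖ ^ 2 ≤ (1 - 1 / χ) * ‖e + p‖ ^ 2) :
    10 * inner ℝ p e + 5 * ‖e'‖ ^ 2 ≤ 5 * ‖e‖ ^ 2 + 20 * χ * ‖p‖ ^ 2 := by
  have hχ0 : 0 < χ := by linarith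
  -- the square that absorbs the cross terms of both `10 ⟪p, e⟫` and `‖e + p‖²`
  have hsq : 0 ≤ ‖e - (2 * χ - 1) • p‖ ^ 2 := sq_nonneg _
  rw [norm_sub_sq_real, real_inner_smul_right, norm_smul, mul_pow, Real.norm_eq_abs, sq_abs] at hsq
  rw [norm_add_sq_real] at he
  rw [real_inner_comm]
  have hsq' : 0 ≤ 5 / χ * (‖e‖ ^ 2 - 2 * ((2 * χ - 1) * inner ℝ e p)
      + (2 * χ - 1) ^ 2 * ‖p‖ ^ 2) := by positivity
  have hp := sq_nonneg ‖p‖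
  have e1 : 5 / χ * (‖e‖ ^ 2 - 2 * ((2 * χ - 1) * inner ℝ e p) + (2 * χ - 1) ^ 2 * ‖p‖ ^ 2)
      = 5 * (1 / χ * ‖e‖ ^ 2) - 20 * inner ℝ e p + 10 * (1 / χ * inner ℝ e p)
        + 20 * χ * ‖p‖ ^ 2 - 20 * ‖p‖ ^ 2 + 5 * (1 / χ * ‖p‖ ^ 2) := by
    field_simp; ring
  rw [e1] at hsq'
  linarith

/-- One accelerated step on `(y, z) ↦ r / 2 * ‖y + z‖ ^ 2`, where the gradient `g` is only
seen through the compressor `w` of its projection `P g` in the variable `z`. -/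
theorem coupled_gradient_step {P : H →ₗ[ℝ] H} (hP : P.IsSymmetric) {χ r α : ℝ} (hr : 0 < r)
    (hα0 : 0 ≤ α) (hα1 : α ≤ 1)
    {y yb z zb y' yl zl g w : H} (hyl : yl = α • y + (1 - α) • yb)
    (hzl : zl = α • z + (1 - α) • zb) (hg : g = r • (yl + zl))
    (hPw : P w = w) (hw : ‖w - P g‖ ^ 2 ≤ (1 - 1 / χ) * ‖P g‖ ^ 2)
    {cy cz : H} (hz : P z = z) (hcz : P cz = cz) :
    r / 2 * ‖(yl + α • (y' - y)) + (zl - (1 / (2 * r)) • w)‖ ^ 2 ≤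
      α * (r / 2 * ‖cy + cz‖ ^ 2) + (1 - α) * (r / 2 * ‖yb + zb‖ ^ 2)
        + α * inner ℝ g (y' - cy) + α * inner ℝ (P g) (z - cz) + r * α ^ 2 * ‖y' - y‖ ^ 2
        - 1 / (4 * r * χ) * ‖P g‖ ^ 2 := by
  -- the descent inequality
  have hgw : inner ℝ g w = inner ℝ (P g) w := by
    conv_lhs => rw [← hPw]
    exact (hP g w).symm
  have hgz : inner ℝ g (z - cz) = inner ℝ (P g) (z - cz) := by
    rw [hP g (z - cz), map_sub, hz, hcz]
  have hs : yl + zl = (1 / r) • g := by rw [hg, smul_smul, one_div_mul_cancel hr.ne', one_smul]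
  have h1 : r / 2 * ‖(yl + α • (y' - y)) + (zl - (1 / (2 * r)) • w)‖ ^ 2 ≤
      r / 2 * ‖yl + zl‖ ^ 2 + α * inner ℝ g (y' - y) + r * α ^ 2 * ‖y' - y‖ ^ 2
        - 1 / (4 * r * χ) * ‖P g‖ ^ 2 := by
    rw [show (yl + α • (y' - y)) + (zl - (1 / (2 * r)) • w)
      = (yl + zl) + (α • (y' - y) - (1 / (2 * r)) • w) by abel, norm_add_sq_real]
    have q1 : inner ℝ (yl + zl) (α • (y' - y) - (1 / (2 * r)) • w)
        = 1 / r * (α * inner ℝ g (y' - y) - 1 / (2 * r) * inner ℝ (P g) w) := by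
      rw [hs, real_inner_smul_left, inner_sub_right, real_inner_smul_right, real_inner_smul_right,
        hgw]
    have q2 : ‖α • (y' - y) - (1 / (2 * r)) • w‖ ^ 2 ≤
        2 * (α ^ 2 * ‖y' - y‖ ^ 2) + 2 * ((1 / (2 * r)) ^ 2 * ‖w‖ ^ 2) := by
      have := parallelogram_law_with_norm ℝ (α • (y' - y)) ((1 / (2 * r)) • w)
      have h3 : ‖α • (y' - y)‖ ^ 2 = α ^ 2 * ‖y' - y‖ ^ 2 := by
        rw [norm_smul, mul_pow, Real.norm_eq_abs, sq_abs]
      have h4 : ‖(1 / (2 * r)) • w‖ ^ 2 = (1 / (2 * r)) ^ 2 * ‖w‖ ^ 2 := by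
        rw [norm_smul, mul_pow, Real.norm_eq_abs, sq_abs]
      nlinarith [sq_nonneg ‖α • (y' - y) + (1 / (2 * r)) • w‖]
    rw [norm_sub_sq_real, real_inner_comm] at hw
    have q3 : 1 / (4 * r) * (‖w‖ ^ 2 - 2 * inner ℝ (P g) w) ≤ - (1 / (4 * r * χ) * ‖P g‖ ^ 2) := by
      have : 1 / (4 * r) * (‖w‖ ^ 2 - 2 * inner ℝ (P g) w) ≤
          1 / (4 * r) * (- (1 / χ) * ‖P g‖ ^ 2) :=
        mul_le_mul_of_nonneg_left (by linarith) (by positivity)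
      refine this.trans_eq ?_
      rw [one_div, one_div, one_div, mul_inv]
      ring
    have q4 := mul_le_mul_of_nonneg_left q2 (show 0 ≤ r / 2 by positivity)
    have q5 : r / 2 * (2 * (α ^ 2 * ‖y' - y‖ ^ 2) + 2 * ((1 / (2 * r)) ^ 2 * ‖w‖ ^ 2))
        = r * α ^ 2 * ‖y' - y‖ ^ 2 + 1 / (4 * r) * ‖w‖ ^ 2 := by
      field_simp; ring
    have q6 : r / 2 * (2 * (1 / r * (α * inner ℝ g (y' - y) - 1 / (2 * r) * inner ℝ (P g) w)))
        = α * inner ℝ g (y' - y) - 1 / (4 * r) * (2 * inner ℝ (P g) w) := by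
      field_simp; ring
    rw [q1]
    linarith
  -- convexity at the extrapolated point
  have h2 : r / 2 * ‖yl + zl‖ ^ 2 + α * inner ℝ g ((cy - y) + (cz - z)) ≤
      α * (r / 2 * ‖cy + cz‖ ^ 2) + (1 - α) * (r / 2 * ‖yb + zb‖ ^ 2) := by
    have c1 : r / 2 * ‖α • (cy + cz) + (1 - α) • (yb + zb)‖ ^ 2 ≤
        α * (r / 2 * ‖cy + cz‖ ^ 2) + (1 - α) * (r / 2 * ‖yb + zb‖ ^ 2) := by
      have := norm_sq_convex_combination hα0 hα1 (cy + cz) (yb + zb) 0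
      simp only [sub_zero] at this
      have := mul_le_mul_of_nonneg_left this (show 0 ≤ r / 2 by positivity)
      linarith
    refine le_trans ?_ c1
    rw [show α • (cy + cz) + (1 - α) • (yb + zb)
      = (yl + zl) + α • ((cy - y) + (cz - z)) by rw [hyl, hzl]; module,
      norm_add_sq_real (yl + zl), real_inner_smul_right]
    have : inner ℝ g ((cy - y) + (cz - z)) = r * inner ℝ (yl + zl) ((cy - y) + (cz - z)) := by
      rw [hg, real_inner_smul_left]
    rw [this]
    nlinarith [mul_nonneg hr.le (sq_nonneg ‖α • ((cy - y) + (cz - z))‖)]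
  have h3 : inner ℝ g ((cy - y) + (cz - z))
      = inner ℝ g (y' - y) - inner ℝ g (y' - cy) - inner ℝ (P g) (z - cz) := by
    rw [← hgz, ← inner_sub_right, ← inner_sub_right]; congr 1; abel
  rw [h3] at h2
  linarith

end Abstract

/-! ### The combination of the steps in one outer iteration -/

section Abstract

variable {H : Type*} [NormedAddCommGroup H] [InnerProductSpace ℝ H]

/-- One outer iteration, with the weight `a = 1 / α`, the weight `a'` of the next iteration, and
`b = a γ`. The hypotheses `hin` and
`hdual` are the conclusions of the inner loop and of the coupled gradient step; `d` is
the last increment of `x`, `e` is the consensus error not transmitted yet, and `p` stands for the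
exact projected gradient step. -/
theorem saddle_step {F : H → ℝ} {r χ a a' b δ : ℝ} (hr : 0 < r) (hχ : 1 ≤ χ) (ha : 1 ≤ a)
    (ha' : a' ^ 2 ≤ a ^ 2 + a)
    (hF : ∀ σ : ℝ, 0 ≤ σ → σ ≤ 1 → ∀ u v, F (σ • u + (1 - σ) • v) ≤ σ * F u + (1 - σ) * F v)
    {x d x' xt xb xb' y y' yb yb' z e e' p g Pg cx cy cz : H} {GC GB GN : ℝ}
    (hin : F xt + r / 3 * ‖xt‖ ^ 2 - inner ℝ y' xt + (r / 3 * a + r / 3) * ‖x' - cx‖ ^ 2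
        + r / 6 * a * ‖xt - x‖ ^ 2
      ≤ F cx + r / 3 * ‖cx‖ ^ 2 - inner ℝ y' cx + r / 3 * a * ‖x - cx‖ ^ 2 + δ / a)
    (hdual : GN ≤ a⁻¹ * GC + (1 - a⁻¹) * GB + a⁻¹ * inner ℝ g (y' - cy)
        + a⁻¹ * inner ℝ Pg (z - cz) + 3 / r * a⁻¹ ^ 2 * ‖y' - y‖ ^ 2
        - 1 / (4 * (3 / r) * χ) * ‖Pg‖ ^ 2)
    (hy : y' = y - ((4 * (3 / r))⁻¹ * a) • (g + (x + (b / a) • d)))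
    (hp : p = ((10 * (3 / r) * χ ^ 2)⁻¹ * a) • Pg)
    (he : ‖e'‖ ^ 2 ≤ (1 - 1 / χ) * ‖e + p‖ ^ 2)
    (hxb : xb' = a⁻¹ • xt + (1 - a⁻¹) • xb) (hyb : yb' = a⁻¹ • y' + (1 - a⁻¹) • yb) :
    a ^ 2 * (F xb' + r / 3 * ‖xb'‖ ^ 2 - inner ℝ cy xb' - GC
        - (F cx + r / 3 * ‖cx‖ ^ 2 - inner ℝ yb' cx - GN))
      - (a ^ 2 - a) * (F xb + r / 3 * ‖xb‖ ^ 2 - inner ℝ cy xb - GC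
        - (F cx + r / 3 * ‖cx‖ ^ 2 - inner ℝ yb cx - GB))
      + (r / 3 * a' ^ 2 * ‖x' - cx‖ ^ 2 + 6 / r * ‖y' - cy‖ ^ 2
        + 15 / r * χ ^ 2 * (‖z - e - p - cz‖ ^ 2 + ‖e'‖ ^ 2)
        - a * inner ℝ (y' - cy) (xt - x) + r / 12 * a ^ 2 * ‖xt - x‖ ^ 2)
    ≤ r / 3 * a ^ 2 * ‖x - cx‖ ^ 2 + 6 / r * ‖y - cy‖ ^ 2
        + 15 / r * χ ^ 2 * (‖z - e - cz‖ ^ 2 + ‖e‖ ^ 2)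
        - b * inner ℝ (y - cy) d + r / 12 * b ^ 2 * ‖d‖ ^ 2 + δ := by
  have ha0 : 0 < a := by linarith
  have hχ0 : 0 < χ := by linarith
  have hi0 : 0 ≤ a⁻¹ := by positivity
  have hi1 : a⁻¹ ≤ 1 := inv_le_one_of_one_le₀ ha
  -- the primal average
  have A : a ^ 2 * (F xb' + r / 3 * ‖xb'‖ ^ 2) ≤
      a * (F xt + r / 3 * ‖xt‖ ^ 2) + (a ^ 2 - a) * (F xb + r / 3 * ‖xb‖ ^ 2) := by
    have h1 := hF a⁻¹ hi0 hi1 xt xb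
    have h2 := norm_sq_convex_combination hi0 hi1 xt xb 0
    simp only [sub_zero] at h2
    rw [← hxb] at h1 h2
    have h3 := mul_le_mul_of_nonneg_left h2 (show 0 ≤ r / 3 by positivity)
    have h4 := mul_le_mul_of_nonneg_left (add_le_add h1 h3) (sq_nonneg a)
    refine h4.trans_eq ?_
    field_simp
    ring
  have B := mul_le_mul_of_nonneg_left hin ha0.le
  have hδ : a * (δ / a) = δ := by field_simp
  have C : a ^ 2 * GN ≤ a * GC + (a ^ 2 - a) * GB + inner ℝ (a • g) (y' - cy)
      + inner ℝ (a • Pg) (z - cz) + 3 / r * ‖y' - y‖ ^ 2 - r / (12 * χ) * ‖a • Pg‖ ^ 2 := by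
    refine (mul_le_mul_of_nonneg_left hdual (sq_nonneg a)).trans_eq ?_
    rw [real_inner_smul_left, real_inner_smul_left, norm_smul, mul_pow, Real.norm_eq_abs, sq_abs]
    field_simp
    ring
  -- the step in `y`
  have hag : a • g = (12 / r) • (y - y') - a • x - b • d := by
    rw [hy, sub_sub_cancel, smul_smul, show 12 / r * ((4 * (3 / r))⁻¹ * a) = a by field_simp; ring]
    rw [smul_add, smul_add, smul_smul, mul_div_cancel₀ _ ha0.ne']
    abel
  have D : inner ℝ (a • g) (y' - cy) = 6 / r * (‖y - cy‖ ^ 2 - ‖y' - cy‖ ^ 2 - ‖y' - y‖ ^ 2)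
      - a * inner ℝ x (y' - cy) - b * inner ℝ d (y' - cy) := by
    rw [hag, inner_sub_left, inner_sub_left, real_inner_smul_left, real_inner_smul_left,
      real_inner_smul_left]
    have := two_inner_sub_sub y' y cy
    have h2 : inner ℝ (y - y') (y' - cy) = - inner ℝ (y' - y) (y' - cy) := by
      rw [← inner_neg_left, neg_sub]
    rw [h2, show inner ℝ (y' - y) (y' - cy)
      = (‖y' - y‖ ^ 2 + ‖y' - cy‖ ^ 2 - ‖y - cy‖ ^ 2) / 2 by linarith]
    ring
  -- the step in `z`
  have haP : a • Pg = (30 * χ ^ 2 / r) • p := by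
    rw [hp, smul_smul]; congr 1; field_simp; ring
  have E1 : inner ℝ (a • Pg) (z - cz) = 15 * χ ^ 2 / r *
      (‖z - e - cz‖ ^ 2 - ‖z - e - p - cz‖ ^ 2 + ‖p‖ ^ 2) + 3 * χ ^ 2 / r * (10 * inner ℝ p e) := by
    have h1 := norm_sub_sq_real (z - e - cz) p
    rw [show z - e - cz - p = z - e - p - cz by abel] at h1
    rw [haP, show z - cz = (z - e - cz) + e by abel, real_inner_smul_left, inner_add_right, h1,
      real_inner_comm p (z - e - cz)]
    ring
  have E2 : r / (12 * χ) * ‖a • Pg‖ ^ 2 = 3 * χ ^ 2 / r * (25 * χ * ‖p‖ ^ 2) := by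
    rw [haP, norm_smul, mul_pow, Real.norm_eq_abs, sq_abs]
    field_simp; ring
  have E3 := mul_le_mul_of_nonneg_left (error_feedback_step hχ he)
    (show 0 ≤ 3 * χ ^ 2 / r by positivity)
  have E4 : 0 ≤ 3 * χ ^ 2 / r * (5 * ((χ - 1) * ‖p‖ ^ 2)) := by
    have : 0 ≤ χ - 1 := by linarith
    positivity
  -- Young's inequality for the delayed increment
  have Y : - (b * inner ℝ d (y' - y)) ≤ 3 / r * ‖y' - y‖ ^ 2 + r / 12 * b ^ 2 * ‖d‖ ^ 2 := by
    have h1 := norm_add_sq_real ((r * b / 6) • d) (y' - y)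
    rw [norm_smul, mul_pow, Real.norm_eq_abs, sq_abs, real_inner_smul_left] at h1
    have h2 : 0 ≤ 3 / r * ‖(r * b / 6) • d + (y' - y)‖ ^ 2 := by positivity
    rw [h1] at h2
    have h3 : 3 / r * ((r * b / 6) ^ 2 * ‖d‖ ^ 2 + 2 * (r * b / 6 * inner ℝ d (y' - y))
        + ‖y' - y‖ ^ 2)
        = r / 12 * b ^ 2 * ‖d‖ ^ 2 + b * inner ℝ d (y' - y) + 3 / r * ‖y' - y‖ ^ 2 := by
      field_simp; ring
    linarith
  have X1 : 0 ≤ r / 3 * (a ^ 2 + a - a' ^ 2) * ‖x' - cx‖ ^ 2 := by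
    have : 0 ≤ a ^ 2 + a - a' ^ 2 := by linarith
    positivity
  have X2 : 0 ≤ r / 12 * a ^ 2 * ‖xt - x‖ ^ 2 := by positivity
  have I1 : a ^ 2 * inner ℝ cy xb' = a * inner ℝ cy xt + (a ^ 2 - a) * inner ℝ cy xb := by
    rw [hxb, inner_add_right, real_inner_smul_right, real_inner_smul_right]
    field_simp
  have I2 : a ^ 2 * inner ℝ yb' cx = a * inner ℝ y' cx + (a ^ 2 - a) * inner ℝ yb cx := by
    rw [hyb, inner_add_left, real_inner_smul_left, real_inner_smul_left]
    field_simp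
  have I3 : inner ℝ (y' - cy) (xt - x)
      = inner ℝ y' xt - inner ℝ cy xt - inner ℝ x (y' - cy) := by
    rw [inner_sub_right, inner_sub_left, real_inner_comm (y' - cy) x]
  have I4 : inner ℝ (y - cy) d = inner ℝ d (y' - cy) - inner ℝ d (y' - y) := by
    rw [real_inner_comm, ← inner_sub_right]; congr 1; abel
  rw [D, E1, E2] at C
  rw [hδ.symm, I3, I4]
  have W1 : 15 / r * χ ^ 2 = 15 * χ ^ 2 / r := by ring
  rw [W1]
  have W2 : 15 * χ ^ 2 / r = 5 * (3 * χ ^ 2 / r) := by ring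
  have W3 : 6 / r = 2 * (3 / r) := by ring
  rw [W2] at C ⊢
  rw [W3] at C ⊢
  linarith

end Abstract

/-! ### Node vectors, centering and gossip -/

/-- The objective `x ↦ ∑ᵢ fᵢ(xᵢ)` of the copies of the decision variable at the nodes. -/
def sumObjective {n d : ℕ} (f : Fin n → EuclideanSpace ℝ (Fin d) → ℝ) (x : Nodes n d) : ℝ :=
  ∑ i, f i (x i)

/-- The subgradients computed by all nodes, as a vector of `(ℝ^d)^n`. -/
def nodeSubgradients {n d : ℕ}
    (oracle : Fin n → EuclideanSpace ℝ (Fin d) → EuclideanSpace ℝ (Fin d))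
    (v : Nodes n d) : Nodes n d :=
  WithLp.toLp 2 (fun i => oracle i (v i))

theorem sumObjective_subgradient {n d : ℕ} {f : Fin n → EuclideanSpace ℝ (Fin d) → ℝ}
    {oracle : Fin n → EuclideanSpace ℝ (Fin d) → EuclideanSpace ℝ (Fin d)}
    (ho : IsSubgradientOracle f oracle) (v w : Nodes n d) :
    sumObjective f v + inner ℝ (nodeSubgradients oracle v) (w - v) ≤ sumObjective f w := by
  rw [sumObjective, sumObjective, PiLp.inner_apply, ← Finset.sum_add_distrib]
  exact Finset.sum_le_sum fun i _ => ho i (v i) (w i)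

theorem norm_subgradient_le {n d : ℕ} {f : Fin n → EuclideanSpace ℝ (Fin d) → ℝ}
    {oracle : Fin n → EuclideanSpace ℝ (Fin d) → EuclideanSpace ℝ (Fin d)} {M : ℝ}
    (ho : IsSubgradientOracle f oracle) (hM : 0 ≤ M)
    (hL : ∀ i x u, |f i x - f i u| ≤ M * ‖x - u‖) (i : Fin n) (x : EuclideanSpace ℝ (Fin d)) :
    ‖oracle i x‖ ≤ M := by
  have h1 := ho i x (x + oracle i x)
  have h2 := (abs_le.1 (hL i (x + oracle i x) x)).2
  rw [add_sub_cancel_left, real_inner_self_eq_norm_sq] at h1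
  rw [add_sub_cancel_left] at h2
  by_contra! h
  nlinarith [norm_nonneg (oracle i x)]

theorem Nodes.norm_sq_eq {n d : ℕ} (v : Nodes n d) : ‖v‖ ^ 2 = ∑ i, ‖v i‖ ^ 2 :=
  PiLp.norm_sq_eq_of_L2 _ v

theorem Nodes.norm_sq_le {n d : ℕ} {v : Nodes n d} {M : ℝ} (h : ∀ i, ‖v i‖ ≤ M) :
    ‖v‖ ^ 2 ≤ n * M ^ 2 := by
  rw [Nodes.norm_sq_eq]
  calc ∑ i, ‖v i‖ ^ 2 ≤ ∑ _i : Fin n, M ^ 2 :=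
        Finset.sum_le_sum fun i _ => pow_le_pow_left₀ (norm_nonneg _) (h i) 2
    _ = n * M ^ 2 := by simp

noncomputable section

/-- The average of the blocks. -/
def blockMean {n d : ℕ} (v : Nodes n d) : EuclideanSpace ℝ (Fin d) := (1 / (n : ℝ)) • ∑ i, v i

/-- The orthogonal projection of `(ℝ^d)^n` onto the vectors whose blocks sum to zero. -/
def center (n d : ℕ) : Nodes n d →ₗ[ℝ] Nodes n d where
  toFun v := WithLp.toLp 2 (fun i => v i - blockMean v)
  map_add' u v := by
    ext i j
    simp [blockMean, Finset.sum_add_distrib]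
    ring
  map_smul' c v := by
    ext i j
    simp [blockMean, Finset.mul_sum, mul_sub]
    ring_nf

end

theorem center_apply {n d : ℕ} (v : Nodes n d) (i : Fin n) :
    center n d v i = v i - blockMean v := rfl

theorem sum_eq_smul_blockMean {n d : ℕ} (hn : 1 ≤ n) (v : Nodes n d) :
    ∑ i, v i = (n : ℝ) • blockMean v := by
  have : (n : ℝ) ≠ 0 := by positivity
  rw [blockMean, smul_smul, mul_one_div_cancel this, one_smul]

theorem sum_center {n d : ℕ} (hn : 1 ≤ n) (v : Nodes n d) : ∑ i, center n d v i = 0 := by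
  simp only [center_apply]
  rw [Finset.sum_sub_distrib, sum_eq_smul_blockMean hn, Finset.sum_const, Finset.card_univ,
    Fintype.card_fin, ← Nat.cast_smul_eq_nsmul ℝ, sub_self]

theorem center_eq_self {n d : ℕ} {v : Nodes n d} (hv : ∑ i, v i = 0) : center n d v = v := by
  refine PiLp.ext fun i => ?_
  rw [center_apply, blockMean, hv, smul_zero, sub_zero]

theorem center_isSymmetric {n d : ℕ} (hn : 1 ≤ n) : (center n d).IsSymmetric := by
  intro u v
  rw [PiLp.inner_apply, PiLp.inner_apply]
  simp only [center_apply, inner_sub_left, inner_sub_right]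
  rw [Finset.sum_sub_distrib, Finset.sum_sub_distrib, ← inner_sum, ← sum_inner,
    sum_eq_smul_blockMean hn, sum_eq_smul_blockMean hn, real_inner_smul_left,
    real_inner_smul_right]

theorem norm_center_le {n d : ℕ} (hn : 1 ≤ n) (v : Nodes n d) : ‖center n d v‖ ≤ ‖v‖ := by
  have h1 : ‖center n d v‖ ^ 2 = inner ℝ (center n d v) v := by
    rw [← real_inner_self_eq_norm_sq, ← center_isSymmetric hn, center_eq_self (sum_center hn v)]
  have h2 := real_inner_le_norm (center n d v) v
  by_contra! h
  nlinarith [norm_nonneg v, norm_nonneg (center n d v)]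

theorem gossip_apply {n d : ℕ} (A : Matrix (Fin n) (Fin n) ℝ) (g : Nodes n d) (i : Fin n) :
    gossip A g i = ∑ j, A i j • g j := rfl

theorem gossip_center {n d : ℕ} {A : Matrix (Fin n) (Fin n) ℝ}
    (hA : A.mulVec (fun _ => 1) = 0) (g : Nodes n d) : gossip A (center n d g) = gossip A g := by
  refine PiLp.ext fun i => ?_
  have h : ∑ j, A i j = 0 := by simpa [Matrix.mulVec, dotProduct] using congrFun hA i
  simp only [gossip_apply, center_apply, smul_sub]
  rw [Finset.sum_sub_distrib, ← Finset.sum_smul, h, zero_smul, sub_zero]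

theorem sum_gossip {n d : ℕ} {A : Matrix (Fin n) (Fin n) ℝ}
    (hA : A.transpose.mulVec (fun _ => 1) = 0) (g : Nodes n d) : ∑ i, gossip A g i = 0 := by
  simp only [gossip_apply]
  rw [Finset.sum_comm]
  refine Finset.sum_eq_zero fun j _ => ?_
  have h : ∑ i, A i j = 0 := by
    simpa [Matrix.mulVec, dotProduct, Matrix.transpose] using congrFun hA j
  rw [← Finset.sum_smul, h, zero_smul]

theorem Nodes.norm_sq_eq_sum_coord {n d : ℕ} (v : Nodes n d) :
    ‖v‖ ^ 2 = ∑ c : Fin d, ‖WithLp.toLp 2 (fun i => v i c)‖ ^ 2 := by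
  rw [Nodes.norm_sq_eq]
  simp only [EuclideanSpace.norm_sq_eq]
  exact Finset.sum_comm

/-- The contraction property of a gossip matrix carries over to `(ℝ^d)^n` coordinate by
coordinate. -/
theorem norm_gossip_sub_center_sq_le {n d : ℕ} (hn : 1 ≤ n) {A : Matrix (Fin n) (Fin n) ℝ} {ρ : ℝ}
    (hA : A.mulVec (fun _ => 1) = 0)
    (hρ : ∀ x : Fin n → ℝ, ∑ i, x i = 0 →
      ‖WithLp.toLp 2 (A.mulVec x - x)‖ ^ 2 ≤ ρ * ‖WithLp.toLp 2 x‖ ^ 2) (g : Nodes n d) :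
    ‖gossip A g - center n d g‖ ^ 2 ≤ ρ * ‖center n d g‖ ^ 2 := by
  rw [← gossip_center hA]
  have hs := sum_center hn g
  generalize center n d g = v at hs ⊢
  rw [Nodes.norm_sq_eq_sum_coord, Nodes.norm_sq_eq_sum_coord, Finset.mul_sum]
  refine Finset.sum_le_sum fun c _ => ?_
  have hc : ∑ i, v i c = 0 := by simpa using congrArg (fun w => w c) hs
  have h : (fun i => (gossip A v - v) i c) = A.mulVec (fun i => v i c) - fun i => v i c := by
    funext i
    simp [gossip_apply, Matrix.mulVec, dotProduct]
  rw [h]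
  exact hρ _ hc

/-! ### Decrease of the potential along the algorithm -/

theorem sum_Icc_one_eq_sum_range {E : Type*} [AddCommMonoid E] (h : ℕ → E) (T : ℕ) :
    ∑ t ∈ Finset.Icc 1 T, h t = ∑ t ∈ Finset.range T, h (t + 1) := by
  induction T with
  | zero => simp
  | succ T ih => rw [Finset.sum_Icc_succ_top (by omega), Finset.sum_range_succ, ih]

theorem innerLoop_count {n d : ℕ}
    (oracle : Fin n → EuclideanSpace ℝ (Fin d) → EuclideanSpace ℝ (Fin d))
    (η β τ : ℝ) (y x : Nodes n d) (c t : ℕ) : (innerLoop oracle η β τ y x c t).2 = c + t := by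
  induction t with
  | zero => rfl
  | succ t ih => rw [innerLoop, ih, add_assoc]

theorem algState_comms {n d : ℕ} (P : AlgParams)
    (oracle : Fin n → EuclideanSpace ℝ (Fin d) → EuclideanSpace ℝ (Fin d))
    (A : ℕ → Matrix (Fin n) (Fin n) ℝ) (T k : ℕ) : (algState P oracle A T k).comms = k := by
  induction k with
  | zero => rfl
  | succ k ih => rw [algState, outerStep, ih]

theorem algState_subgrads {n d : ℕ} (P : AlgParams)
    (oracle : Fin n → EuclideanSpace ℝ (Fin d) → EuclideanSpace ℝ (Fin d))
    (A : ℕ → Matrix (Fin n) (Fin n) ℝ) (T k : ℕ) :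
    (algState P oracle A T k).subgrads = k * T := by
  induction k with
  | zero => exact (Nat.zero_mul T).symm
  | succ k ih => rw [algState, outerStep, innerLoop_count, ih, Nat.succ_mul]

/-- The dual variables `z` and `z̄` stay in the space of vectors whose blocks sum to zero. -/
theorem algState_sum_z {n d : ℕ} (P : AlgParams)
    (oracle : Fin n → EuclideanSpace ℝ (Fin d) → EuclideanSpace ℝ (Fin d))
    {A : ℕ → Matrix (Fin n) (Fin n) ℝ} (hA : ∀ k, (A k).transpose.mulVec (fun _ => 1) = 0)
    (T k : ℕ) : ∑ i, (algState P oracle A T k).z i = 0 ∧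
      ∑ i, (algState P oracle A T k).zBar i = 0 := by
  induction k with
  | zero => simp [algState]
  | succ k ih =>
    constructor
    · simp only [algState, outerStep, PiLp.sub_apply, PiLp.smul_apply, Finset.sum_sub_distrib,
        ← Finset.smul_sum, sum_gossip (hA k), ih.1, smul_zero, sub_zero]
    · simp only [algState, outerStep, PiLp.sub_apply, PiLp.add_apply, PiLp.smul_apply,
        Finset.sum_sub_distrib, Finset.sum_add_distrib,
        ← Finset.smul_sum, sum_gossip (hA k), ih.1, ih.2, smul_zero, sub_zero, add_zero]

noncomputable section

/-- The difference `L(x̄, cy, cz) - L(cx, ȳ, z̄)` of the values of the saddle function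
`L(x, y, z) = ∑ᵢ fᵢ(xᵢ) + (r / 3) ‖x‖² - ⟪y, x⟫ - G(y, z)`, where `G` is the coupling with
constant `3 / r`. -/
def saddleGap {n d : ℕ} (f : Fin n → EuclideanSpace ℝ (Fin d) → ℝ) (r : ℝ)
    (cx cy cz : Nodes n d) (s : AlgState n d) : ℝ :=
  sumObjective f s.xBar + r / 3 * ‖s.xBar‖ ^ 2 - inner ℝ cy s.xBar - coupling (3 / r) cy cz
    - (sumObjective f cx + r / 3 * ‖cx‖ ^ 2 - inner ℝ s.yBar cx
      - coupling (3 / r) s.yBar s.zBar)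

/-- The part of the `z`-steps before iteration `k` that the communication rounds have not
transmitted: `η_z^k` times the projection of `m^k`. -/
def consensusError {n d : ℕ} (r χ : ℝ) (k : ℕ) (s : AlgState n d) : Nodes n d :=
  ((10 * (3 / r) * χ ^ 2)⁻¹ * (((k : ℝ) + 3) / 3)) • center n d s.m

/-- The Lyapunov function at the beginning of iteration `k`, for the comparison point
`(cx, cy, cz)`. -/
def potential {n d : ℕ} (r χ : ℝ) (cx cy cz : Nodes n d) (k : ℕ) (s : AlgState n d) : ℝ :=
  r / 3 * (((k : ℝ) + 3) / 3) ^ 2 * ‖s.x - cx‖ ^ 2 + 6 / r * ‖s.y - cy‖ ^ 2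
    + 15 / r * χ ^ 2 *
      (‖s.z - consensusError r χ k s - cz‖ ^ 2 + ‖consensusError r χ k s‖ ^ 2)
    - ((k : ℝ) + 2) / 3 * inner ℝ (s.y - cy) (s.xTilde - s.xPrev)
    + r / 12 * (((k : ℝ) + 2) / 3) ^ 2 * ‖s.xTilde - s.xPrev‖ ^ 2

end

theorem potential_nonneg {n d : ℕ} {r χ : ℝ} (hr : 0 < r) (cx cy cz : Nodes n d) (k : ℕ)
    (s : AlgState n d) : 0 ≤ potential r χ cx cy cz k s := by
  unfold potential
  generalize ((k : ℝ) + 2) / 3 = b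
  have h1 := norm_sub_sq_real (s.y - cy) ((r * b / 12) • (s.xTilde - s.xPrev))
  rw [norm_smul, mul_pow, Real.norm_eq_abs, sq_abs, real_inner_smul_right] at h1
  have h2 : 0 ≤ 6 / r * ‖s.y - cy - (r * b / 12) • (s.xTilde - s.xPrev)‖ ^ 2 := by positivity
  rw [h1] at h2
  have h3 : 6 / r * (‖s.y - cy‖ ^ 2 - 2 * (r * b / 12 * inner ℝ (s.y - cy) (s.xTilde - s.xPrev))
      + (r * b / 12) ^ 2 * ‖s.xTilde - s.xPrev‖ ^ 2)
      = 6 / r * ‖s.y - cy‖ ^ 2 - b * inner ℝ (s.y - cy) (s.xTilde - s.xPrev)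
        + r / 24 * b ^ 2 * ‖s.xTilde - s.xPrev‖ ^ 2 := by
    field_simp; ring
  have h4 : 0 ≤ r / 24 * b ^ 2 * ‖s.xTilde - s.xPrev‖ ^ 2 := by positivity
  have h5 : 0 ≤ r / 3 * (((k : ℝ) + 3) / 3) ^ 2 * ‖s.x - cx‖ ^ 2 := by positivity
  have h6 : 0 ≤ 15 / r * χ ^ 2 *
      (‖s.z - consensusError r χ k s - cz‖ ^ 2 + ‖consensusError r χ k s‖ ^ 2) := by positivity
  linarith

set_option maxHeartbeats 1000000 in
/-- Decrease of the potential in one outer iteration. -/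
theorem potential_step {n d : ℕ} (hn : 1 ≤ n) {r χ : ℝ} (hr : 0 < r) (hχ : 1 ≤ χ)
    {f : Fin n → EuclideanSpace ℝ (Fin d) → ℝ}
    {oracle : Fin n → EuclideanSpace ℝ (Fin d) → EuclideanSpace ℝ (Fin d)} {B : ℝ}
    (ho : IsSubgradientOracle f oracle) (hB : ∀ v : Nodes n d, ‖nodeSubgradients oracle v‖ ≤ B)
    {A : Matrix (Fin n) (Fin n) ℝ} (hA1 : A.mulVec (fun _ => 1) = 0)
    (hA2 : A.transpose.mulVec (fun _ => 1) = 0)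
    (hA : ∀ x : Fin n → ℝ, ∑ i, x i = 0 →
      ‖WithLp.toLp 2 (A.mulVec x - x)‖ ^ 2 ≤ (1 - 1 / χ) * ‖WithLp.toLp 2 x‖ ^ 2)
    {cx cy cz : Nodes n d} (hcz : ∑ i, cz i = 0)
    (K k : ℕ) {T : ℕ} (hT : 1 ≤ T) (s : AlgState n d) (hz : ∑ i, s.z i = 0) :
    (((k : ℝ) + 3) / 3) ^ 2 *
        saddleGap f r cx cy cz (outerStep (algParams r χ K T) oracle A T k s)
      - ((((k : ℝ) + 3) / 3) ^ 2 - ((k : ℝ) + 3) / 3) * saddleGap f r cx cy cz s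
      + potential r χ cx cy cz (k + 1) (outerStep (algParams r χ K T) oracle A T k s)
    ≤ potential r χ cx cy cz k s + 6 * B ^ 2 / (r * T) := by
  have hk : (0 : ℝ) ≤ k := Nat.cast_nonneg k
  have hT0 : (0 : ℝ) < T := by positivity
  have hχ0 : 0 < χ := by linarith
  set s' := outerStep (algParams r χ K T) oracle A T k s with hs'
  set a : ℝ := ((k : ℝ) + 3) / 3 with ha_def
  have ha : 1 ≤ a := by rw [ha_def]; linarith
  have ha0 : 0 < a := by linarith
  have hα : (algParams r χ K T).α k = a⁻¹ := by
    change 3 / ((k : ℝ) + 3) = a⁻¹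
    rw [ha_def, inv_div]
  have hα0 : 0 ≤ a⁻¹ := by positivity
  have hα1 : a⁻¹ ≤ 1 := inv_le_one_of_one_le₀ ha
  have hβ : (algParams r χ K T).β k = 2 / 3 * r := rfl
  have hτ : (algParams r χ K T).τx k = r / 3 * a := by
    change 2 / 3 * r / 2 * ((algParams r χ K T).α k)⁻¹ = r / 3 * a
    rw [hα, inv_inv]; ring
  have hηx : (algParams r χ K T).ηx k = 1 / (r / 3 * a * T) := by
    rw [← hτ]; rfl
  have hσ : (algParams r χ K T).σ k = r / 3 * a / (2 * (r / 3 * a) + 2 / 3 * r) := by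
    rw [← hτ]; rfl
  have hηy : (algParams r χ K T).ηy k = (4 * (3 / r))⁻¹ * a := by
    change (4 * (3 / r))⁻¹ * ((algParams r χ K T).α k)⁻¹ = _
    rw [hα, inv_inv]
  have hηz (j : ℕ) : (algParams r χ K T).ηz j = (10 * (3 / r) * χ ^ 2)⁻¹ * (((j : ℝ) + 3) / 3) := by
    change (10 * (3 / r) * χ ^ 2)⁻¹ * (3 / ((j : ℝ) + 3))⁻¹ = _
    rw [inv_div]
  have hηzk : (algParams r χ K T).ηz k = (10 * (3 / r) * χ ^ 2)⁻¹ * a := hηz k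
  have hγ : (algParams r χ K T).γ k = ((k : ℝ) + 2) / 3 / a := by
    change ((k : ℝ) + 2) / ((k : ℝ) + 3) = _
    rw [ha_def]; field_simp
  -- the inner loop
  let u : ℕ → Nodes n d := fun t =>
    (innerLoop oracle (1 / (r / 3 * a * T)) (2 / 3 * r) (r / 3 * a) s'.y s.x s.subgrads t).1
  have hu (t : ℕ) : u (t + 1) = u t - (1 / (r / 3 * a * T)) • (nodeSubgradients oracle (u t)
      + (2 / 3 * r) • u (t + 1) - s'.y + (r / 3 * a) • (u (t + 1) - s.x)) :=
    (innerStep_iff oracle _ _ _ _ _ _ _ (by positivity)).1 rfl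
  have hxt : s'.xTilde = (1 / (T : ℝ)) • ∑ t ∈ Finset.range T, u (t + 1) := by
    rw [← sum_Icc_one_eq_sum_range]
    simp only [u, ← hβ, ← hτ]
    rfl
  have hx' : s'.x = (r / 3 * a / (2 * (r / 3 * a) + 2 / 3 * r)) • u T
      + (1 - r / 3 * a / (2 * (r / 3 * a) + 2 / 3 * r)) • s'.xTilde := by
    rw [← hσ]
    simp only [u, ← hβ, ← hτ]
    rfl
  have hin := proximal_subgradient_loop (sumObjective_subgradient ho) hB
    (show 0 < 2 / 3 * r by positivity) (show 0 < r / 3 * a by positivity) hT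
    (show u 0 = s.x from rfl) hu hxt hx' cx
  have hδ : 2 * B ^ 2 / (r / 3 * a * T) = 6 * B ^ 2 / (r * T) / a := by field_simp; ring
  rw [show 2 / 3 * r / 2 = r / 3 by ring, hδ, show r / 3 * a / 2 = r / 6 * a by ring] at hin
  -- the coupled gradient step
  let yl := a⁻¹ • s.y + (1 - a⁻¹) • s.yBar
  let zl := a⁻¹ • s.z + (1 - a⁻¹) • s.zBar
  let g := (3 / r) • (yl + zl)
  have hyb : s'.yBar = yl + a⁻¹ • (s'.y - s.y) := by
    simp only [yl, ← hα]; rfl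
  have hzb : s'.zBar = zl - (1 / (2 * (3 / r))) • gossip A g := by
    simp only [g, yl, zl, ← hα]; rfl
  have hy' : s'.y = s.y - ((4 * (3 / r))⁻¹ * a) •
      (g + (s.x + (((k : ℝ) + 2) / 3 / a) • (s.xTilde - s.xPrev))) := by
    simp only [g, yl, zl, ← hα, ← hηy, ← hγ]; rfl
  have hz' : s'.z = s.z - ((10 * (3 / r) * χ ^ 2)⁻¹ * a) • gossip A (g + s.m) := by
    simp only [g, yl, zl, ← hα, ← hηzk]; rfl
  have hm' : s'.m = (((10 * (3 / r) * χ ^ 2)⁻¹ * a) /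
      ((10 * (3 / r) * χ ^ 2)⁻¹ * ((((k + 1 : ℕ) : ℝ) + 3) / 3))) •
        (s.m + g - gossip A (g + s.m)) := by
    simp only [g, yl, zl, ← hα, ← hηzk, ← hηz]; rfl
  have hdual := coupled_gradient_step (center_isSymmetric hn) (χ := χ) (show 0 < 3 / r by positivity)
    hα0 hα1 (y' := s'.y) (yl := yl) (zl := zl) (g := g) rfl rfl rfl
    (center_eq_self (sum_gossip hA2 g)) (norm_gossip_sub_center_sq_le hn hA1 hA g) (cy := cy)
    (center_eq_self hz) (center_eq_self hcz)
  rw [← hyb, ← hzb] at hdual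
  -- the error feedback
  have hηz0 : (10 * (3 / r) * χ ^ 2)⁻¹ * ((((k + 1 : ℕ) : ℝ) + 3) / 3) ≠ 0 := by positivity
  have he' : consensusError r χ (k + 1) s' = ((10 * (3 / r) * χ ^ 2)⁻¹ * a) •
      (center n d (g + s.m) - gossip A (g + s.m)) := by
    rw [consensusError, hm', map_smul, smul_smul, mul_div_cancel₀ _ hηz0, map_sub,
      center_eq_self (sum_gossip hA2 _), add_comm s.m g]
  have hep : consensusError r χ k s + ((10 * (3 / r) * χ ^ 2)⁻¹ * a) • center n d g
      = ((10 * (3 / r) * χ ^ 2)⁻¹ * a) • center n d (g + s.m) := by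
    rw [consensusError, map_add]; module
  have he : ‖consensusError r χ (k + 1) s'‖ ^ 2 ≤ (1 - 1 / χ) *
      ‖consensusError r χ k s + ((10 * (3 / r) * χ ^ 2)⁻¹ * a) • center n d g‖ ^ 2 := by
    rw [hep, he', norm_smul, norm_smul, mul_pow, mul_pow, norm_sub_rev]
    have := mul_le_mul_of_nonneg_left (norm_gossip_sub_center_sq_le hn hA1 hA (g + s.m))
      (sq_nonneg ‖(10 * (3 / r) * χ ^ 2)⁻¹ * a‖)
    linarith
  have hzz : s'.z - consensusError r χ (k + 1) s'
      = s.z - consensusError r χ k s - ((10 * (3 / r) * χ ^ 2)⁻¹ * a) • center n d g := by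
    rw [sub_sub, hep, he', hz', smul_sub]; abel
  have hxb : s'.xBar = a⁻¹ • s'.xTilde + (1 - a⁻¹) • s.xBar := by rw [← hα]; rfl
  have hyb' : s'.yBar = a⁻¹ • s'.y + (1 - a⁻¹) • s.yBar := by
    rw [hyb]; simp only [yl]; module
  have ha' : ((((k + 1 : ℕ) : ℝ) + 3) / 3) ^ 2 ≤ a ^ 2 + a := by
    rw [ha_def]; push_cast; nlinarith
  have := saddle_step hr hχ ha ha'
    (fun σ h0 h1 => convex_combination_le_of_subgradient (sumObjective_subgradient ho) h0 h1)
    hin hdual hy' rfl he hxb hyb'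
  rw [← hzz] at this
  have hprev : s'.xPrev = s.x := rfl
  have hb' : (((k + 1 : ℕ) : ℝ) + 2) / 3 = a := by rw [ha_def]; push_cast; ring
  simp only [potential, saddleGap, coupling, hprev, hb', ← ha_def]
  linarith

/-! ### Convergence rate -/

/-- Summation by parts: the weights `λₖ` are those that turn up when the one-step inequality
is summed. -/
theorem sum_lam_mul (r χ : ℝ) (m S : ℕ) (Φ : ℕ → ℝ) :
    ∑ k ∈ Finset.Icc 1 (m + 1), (algParams r χ (m + 1) S).lam k * Φ k =
      ∑ k ∈ Finset.range (m + 1), ((((k : ℝ) + 3) / 3) ^ 2 * Φ (k + 1)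
        - ((((k : ℝ) + 3) / 3) ^ 2 - ((k : ℝ) + 3) / 3) * Φ k) := by
  rw [sum_Icc_one_eq_sum_range, Finset.sum_sub_distrib,
    Finset.sum_range_succ' (fun k : ℕ => ((((k : ℝ) + 3) / 3) ^ 2 - ((k : ℝ) + 3) / 3) * Φ k),
    Finset.sum_range_succ, Finset.sum_range_succ, Nat.cast_zero]
  have hlast : (algParams r χ (m + 1) S).lam (m + 1) = (((m : ℝ) + 3) / 3) ^ 2 := by
    simp only [algParams, if_true, add_tsub_cancel_right, div_pow, inv_div]
  have hlam (j : ℕ) (hj : j ∈ Finset.range m) :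
      (algParams r χ (m + 1) S).lam (j + 1) * Φ (j + 1) = (((j : ℝ) + 3) / 3) ^ 2 * Φ (j + 1)
        - (((((j + 1 : ℕ) : ℝ) + 3) / 3) ^ 2 - (((j + 1 : ℕ) : ℝ) + 3) / 3) * Φ (j + 1) := by
    have hne : j ≠ m := (Finset.mem_range.1 hj).ne
    simp only [algParams, add_left_inj, hne, if_false, add_tsub_cancel_right, div_pow, inv_div]
    push_cast
    ring
  rw [hlast, Finset.sum_congr rfl hlam, Finset.sum_sub_distrib]
  ring

theorem sum_lam (r χ : ℝ) (m S : ℕ) :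
    ∑ k ∈ Finset.Icc 1 (m + 1), (algParams r χ (m + 1) S).lam k
      = ((m : ℝ) + 1) * ((m : ℝ) + 6) / 6 := by
  have h := sum_lam_mul r χ m S (fun _ => 1)
  simp only [mul_one, sub_sub_cancel] at h
  rw [h]
  clear h
  induction m with
  | zero => norm_num
  | succ m ih => rw [Finset.sum_range_succ, ih]; push_cast; ring

theorem lam_nonneg (r χ : ℝ) (K S : ℕ) {k : ℕ} (hk : 1 ≤ k) : 0 ≤ (algParams r χ K S).lam k := by
  obtain ⟨j, rfl⟩ := Nat.exists_eq_add_of_le' hk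
  have hj : (0 : ℝ) ≤ j := Nat.cast_nonneg j
  simp only [algParams, add_tsub_cancel_right]
  split_ifs with h
  · rw [← h, add_tsub_cancel_right]; positivity
  · have e : ((3 / ((j : ℝ) + 3)) ^ 2)⁻¹ + (3 / (((j + 1 : ℕ) : ℝ) + 3))⁻¹
        - ((3 / (((j + 1 : ℕ) : ℝ) + 3)) ^ 2)⁻¹ = ((j : ℝ) + 5) / 9 := by
      simp only [div_pow, inv_div]
      push_cast
      ring
    rw [e]
    positivity

noncomputable section

/-- The vector of `(ℝ^d)^n` all of whose blocks are `x`. -/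
def constBlocks (n : ℕ) {d : ℕ} (x : EuclideanSpace ℝ (Fin d)) : Nodes n d :=
  WithLp.toLp 2 (fun _ => x)

end

theorem norm_constBlocks_sq {n d : ℕ} (x : EuclideanSpace ℝ (Fin d)) :
    ‖constBlocks n x‖ ^ 2 = n * ‖x‖ ^ 2 := by
  rw [Nodes.norm_sq_eq]
  simp [constBlocks]

theorem sub_constBlocks_blockMean {n d : ℕ} (v : Nodes n d) :
    v - constBlocks n (blockMean v) = center n d v := rfl

theorem center_constBlocks {n d : ℕ} (hn : 1 ≤ n) (x : EuclideanSpace ℝ (Fin d)) :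
    center n d (constBlocks n x) = 0 := by
  have hn0 : (n : ℝ) ≠ 0 := by positivity
  refine PiLp.ext fun i => ?_
  rw [center_apply, blockMean]
  simp [constBlocks, ← Nat.cast_smul_eq_nsmul ℝ, smul_smul, hn0]

theorem sumObjective_constBlocks {n d : ℕ} (hn : 1 ≤ n)
    (f : Fin n → EuclideanSpace ℝ (Fin d) → ℝ) (x : EuclideanSpace ℝ (Fin d)) :
    sumObjective f (constBlocks n x) = n * objective f 0 x := by
  have hn0 : (n : ℝ) ≠ 0 := by positivity
  simp [sumObjective, objective, constBlocks, hn0]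

/-- For `y = -z` equal to the centered subgradients at a consensus point `xo`, and a consensus
comparison point `xs`, the saddle gap controls the optimality gap of `xo`, up to a term that is
affine in `x̄` and vanishes if `x̄` has mean `xo`. -/
theorem saddleGap_lower_bound {n d : ℕ} (hn : 1 ≤ n) {r : ℝ} (hr : 0 < r)
    {f : Fin n → EuclideanSpace ℝ (Fin d) → ℝ}
    {oracle : Fin n → EuclideanSpace ℝ (Fin d) → EuclideanSpace ℝ (Fin d)}
    (ho : IsSubgradientOracle f oracle) (xo xs : EuclideanSpace ℝ (Fin d)) {G : Nodes n d}
    (hG : G = nodeSubgradients oracle (constBlocks n xo)) (s : AlgState n d)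
    (hz : ∑ i, s.zBar i = 0) :
    n * (objective f 0 xo - objective f 0 xs - r / 2 * ‖xs‖ ^ 2)
        + inner ℝ (G - center n d G) (s.xBar - constBlocks n xo)
      ≤ saddleGap f r (constBlocks n xs) (center n d G) (-center n d G) s := by
  have h1 := sumObjective_subgradient ho (constBlocks n xo) s.xBar
  rw [← hG, sumObjective_constBlocks hn] at h1
  have h2 : inner ℝ (center n d G) (constBlocks n xo) = 0 := by
    rw [center_isSymmetric hn, center_constBlocks hn, inner_zero_right]
  have h3 : inner ℝ s.zBar (constBlocks n xs) = 0 := by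
    rw [← center_eq_self hz, center_isSymmetric hn, center_constBlocks hn, inner_zero_right]
  -- maximizing over `ȳ + z̄` the dual part of the saddle function
  have h4 : - inner ℝ s.yBar (constBlocks n xs) - coupling (3 / r) s.yBar s.zBar
      ≤ r / 6 * (n * ‖xs‖ ^ 2) := by
    have h5 : 0 ≤ r / 6 * ‖constBlocks n xs + (3 / r) • (s.yBar + s.zBar)‖ ^ 2 := by positivity
    rw [norm_add_sq_real, norm_constBlocks_sq, norm_smul, mul_pow, Real.norm_eq_abs, sq_abs,
      real_inner_smul_right, real_inner_comm, inner_add_left, h3] at h5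
    have h6 : r / 6 * (n * ‖xs‖ ^ 2 + 2 * (3 / r * (inner ℝ s.yBar (constBlocks n xs) + 0))
        + (3 / r) ^ 2 * ‖s.yBar + s.zBar‖ ^ 2) = r / 6 * (n * ‖xs‖ ^ 2)
        + inner ℝ s.yBar (constBlocks n xs) + 3 / r / 2 * ‖s.yBar + s.zBar‖ ^ 2 := by
      field_simp; ring
    rw [coupling]
    linarith
  have h7 : 0 ≤ r / 3 * ‖s.xBar‖ ^ 2 := by positivity
  have h8 : coupling (3 / r) (center n d G) (-center n d G) = 0 := by simp [coupling]
  rw [saddleGap, h8, sumObjective_constBlocks hn, norm_constBlocks_sq, inner_sub_left,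
    inner_sub_right (center n d G), h2]
  linarith

/-- The convergence rate of the algorithm, for any regularization `r > 0`. -/
theorem objective_gap_le {n d : ℕ} (hn : 1 ≤ n) {r χ M R : ℝ} (hr : 0 < r) (hχ : 1 ≤ χ)
    (hM : 0 ≤ M) {f : Fin n → EuclideanSpace ℝ (Fin d) → ℝ}
    {oracle : Fin n → EuclideanSpace ℝ (Fin d) → EuclideanSpace ℝ (Fin d)}
    (hL : ∀ i x u, |f i x - f i u| ≤ M * ‖x - u‖) (ho : IsSubgradientOracle f oracle)
    {A : ℕ → Matrix (Fin n) (Fin n) ℝ} (hA1 : ∀ k, (A k).mulVec (fun _ => 1) = 0)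
    (hA2 : ∀ k, (A k).transpose.mulVec (fun _ => 1) = 0)
    (hA : ∀ k, ∀ x : Fin n → ℝ, ∑ i, x i = 0 →
      ‖WithLp.toLp 2 ((A k).mulVec x - x)‖ ^ 2 ≤ (1 - 1 / χ) * ‖WithLp.toLp 2 x‖ ^ 2)
    {xs : EuclideanSpace ℝ (Fin d)} (hxs : ‖xs‖ ≤ R) {N S : ℕ} (hN : 1 ≤ N) (hS : 1 ≤ S) :
    (N : ℝ) * (N + 5) / 6 * (objective f 0 (algOutput (algParams r χ N S) oracle A N S)
        - objective f 0 xs - r / 2 * R ^ 2)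
      ≤ r / 3 * R ^ 2 + 21 * χ ^ 2 * M ^ 2 / r + 6 * M ^ 2 * N / (r * S) := by
  obtain ⟨m, rfl⟩ := Nat.exists_eq_add_of_le' hN
  have hn0 : (0 : ℝ) < n := by positivity
  have hS0 : (0 : ℝ) < S := by positivity
  have hsum := sum_lam r χ m S
  set P := algParams r χ (m + 1) S with hP
  let s := algState P oracle A S
  set xo := algOutput P oracle A (m + 1) S with hxo
  let G : Nodes n d := nodeSubgradients oracle (constBlocks n xo)
  let Φ : ℕ → ℝ := fun k => saddleGap f r (constBlocks n xs) (center n d G) (-center n d G) (s k)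
  let V : ℕ → ℝ := fun k =>
    potential r χ (constBlocks n xs) (center n d G) (-center n d G) k (s k)
  have hsub (v : Nodes n d) : ‖nodeSubgradients oracle v‖ ^ 2 ≤ n * M ^ 2 :=
    Nodes.norm_sq_le fun i => norm_subgradient_le ho hM hL i _
  have hG : ‖center n d G‖ ^ 2 ≤ n * M ^ 2 :=
    (pow_le_pow_left₀ (norm_nonneg _) (norm_center_le hn G) 2).trans (hsub _)
  have hcz : ∑ i, (-center n d G) i = 0 := by
    simp only [PiLp.neg_apply, Finset.sum_neg_distrib, sum_center hn, neg_zero]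
  -- the sum of the one-step inequalities
  have hstep (k : ℕ) : (((k : ℝ) + 3) / 3) ^ 2 * Φ (k + 1)
      - ((((k : ℝ) + 3) / 3) ^ 2 - ((k : ℝ) + 3) / 3) * Φ k
      ≤ V k - V (k + 1) + 6 * (n * M ^ 2) / (r * S) := by
    have h := potential_step hn hr hχ ho (B := √(n * M ^ 2)) (fun v => Real.le_sqrt_of_sq_le (hsub v))
      (hA1 k) (hA2 k) (hA k) (cx := constBlocks n xs) (cy := center n d G) hcz (m + 1) k hS (s k)
      (algState_sum_z P oracle hA2 S k).1
    rw [Real.sq_sqrt (by positivity)] at h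
    simp only [Φ, V, s, algState] at h ⊢
    linarith
  have hV0 : V 0 ≤ n * (r / 3 * R ^ 2 + 21 * χ ^ 2 * M ^ 2 / r) := by
    have e : V 0 = r / 3 * (n * ‖xs‖ ^ 2) + 6 / r * ‖center n d G‖ ^ 2
        + 15 / r * χ ^ 2 * ‖center n d G‖ ^ 2 := by
      simp [V, s, algState, potential, consensusError, norm_constBlocks_sq]
    have h1 : r / 3 * (n * ‖xs‖ ^ 2) ≤ r / 3 * (n * R ^ 2) := by gcongr
    have h2 : 6 / r * ‖center n d G‖ ^ 2 ≤ 6 / r * χ ^ 2 * (n * M ^ 2) := by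
      gcongr
      exact le_mul_of_one_le_right (by positivity) (one_le_pow₀ hχ)
    have h3 : 15 / r * χ ^ 2 * ‖center n d G‖ ^ 2 ≤ 15 / r * χ ^ 2 * (n * M ^ 2) := by gcongr
    rw [e]
    refine (add_le_add (add_le_add h1 h2) h3).trans_eq ?_
    ring
  have hupper : ∑ k ∈ Finset.Icc 1 (m + 1), P.lam k * Φ k ≤
      n * (r / 3 * R ^ 2 + 21 * χ ^ 2 * M ^ 2 / r + 6 * M ^ 2 * (m + 1 : ℕ) / (r * S)) := by
    rw [sum_lam_mul]
    refine (Finset.sum_le_sum fun k _ => hstep k).trans ?_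
    rw [Finset.sum_add_distrib, Finset.sum_range_sub', Finset.sum_const, Finset.card_range,
      nsmul_eq_mul]
    have hVn : 0 ≤ V (m + 1) := potential_nonneg hr _ _ _ _ _
    have e : ((m + 1 : ℕ) : ℝ) * (6 * (n * M ^ 2) / (r * S))
      = n * (6 * M ^ 2 * (m + 1 : ℕ) / (r * S)) := by ring
    rw [e]
    linarith
  -- the lower bound; the affine terms cancel because `xo` is the mean of the weighted average
  have hΛ : 0 < ∑ k ∈ Finset.Icc 1 (m + 1), P.lam k := by rw [hsum]; positivity
  have hzero : ∑ k ∈ Finset.Icc 1 (m + 1), P.lam k *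
      inner ℝ (G - center n d G) ((s k).xBar - constBlocks n xo) = 0 := by
    simp only [← real_inner_smul_right]
    rw [← inner_sum]
    simp only [smul_sub]
    rw [Finset.sum_sub_distrib, ← Finset.sum_smul]
    set xa := (∑ k ∈ Finset.Icc 1 (m + 1), P.lam k)⁻¹ •
      ∑ k ∈ Finset.Icc 1 (m + 1), P.lam k • (s k).xBar with hxa
    have h1 : ∑ k ∈ Finset.Icc 1 (m + 1), P.lam k • (s k).xBar
        = (∑ k ∈ Finset.Icc 1 (m + 1), P.lam k) • xa := by
      rw [hxa, smul_smul, mul_inv_cancel₀ hΛ.ne', one_smul]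
    have h2 : xo = blockMean xa := rfl
    rw [h1, ← smul_sub, h2, sub_constBlocks_blockMean, real_inner_smul_right, inner_sub_left,
      center_isSymmetric hn, center_eq_self (sum_center hn xa), sub_self, mul_zero]
  have hlower := Finset.sum_le_sum fun k (hk : k ∈ Finset.Icc 1 (m + 1)) =>
    mul_le_mul_of_nonneg_left
      (saddleGap_lower_bound hn hr ho xo xs (G := G) rfl (s k) (algState_sum_z P oracle hA2 S k).2)
      (lam_nonneg r χ (m + 1) S (Finset.mem_Icc.1 hk).1)
  simp only [mul_add, Finset.sum_add_distrib] at hlower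
  rw [hzero, ← Finset.sum_mul, hsum, add_zero] at hlower
  have hR : r / 2 * ‖xs‖ ^ 2 ≤ r / 2 * R ^ 2 := by gcongr
  refine le_of_mul_le_mul_left ((le_trans ?_ hlower).trans hupper) hn0
  have e : ((m : ℝ) + 1) * ((m : ℝ) + 6) / 6 = ((m + 1 : ℕ) : ℝ) * ((m + 1 : ℕ) + 5) / 6 := by
    push_cast; ring
  rw [e, mul_left_comm]
  gcongr

/-! ### Complexity -/

theorem theorem4 :
    ∃ C : ℝ, 0 < C ∧
      ∀ M R ε χ : ℝ, 0 ≤ M → 0 < R → 0 < ε → 1 ≤ χ →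
        ∃ K T : ℕ, 1 ≤ K ∧ 1 ≤ T ∧
          -- the complexity bounds, up to rounding `K` and `T` up to positive integers
          (K : ℝ) ≤ C * (χ * M * R / ε) + 1 ∧
          (K : ℝ) * T ≤ C * (M ^ 2 * R ^ 2 / ε ^ 2) + K ∧
          -- the complexity bounds without rounding terms
          (χ * ε ≤ M * R →
            (K : ℝ) ≤ C * (χ * M * R / ε) ∧ (K : ℝ) * T ≤ C * (M ^ 2 * R ^ 2 / ε ^ 2)) ∧
          -- `K` communications and `K * T` subgradient computations are enough
          ∀ (n d : ℕ), 1 ≤ n →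
          ∀ (f : Fin n → EuclideanSpace ℝ (Fin d) → ℝ)
            (oracle : Fin n → EuclideanSpace ℝ (Fin d) → EuclideanSpace ℝ (Fin d))
            (xstar : EuclideanSpace ℝ (Fin d))
            (E : ℝ≥0 → Set (Fin n × Fin n)) (W : ℝ≥0 → Matrix (Fin n) (Fin n) ℝ)
            (time : ℕ → ℝ≥0),
            (∀ i, ConvexOn ℝ Set.univ (f i)) →
            (∀ i x u, |f i x - f i u| ≤ M * ‖x - u‖) →
            IsSubgradientOracle f oracle →
            (∀ x, objective f 0 xstar ≤ objective f 0 x) →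
            ‖xstar‖ ≤ R →
            IsGossip E W →
            HasConditionNumber W χ →
            ∀ N S : ℕ, K ≤ N → K * T ≤ N * S →
              (algState (algParams (ε / R ^ 2) χ N S) oracle (fun k => W (time k)) S N).comms = N ∧
              (algState (algParams (ε / R ^ 2) χ N S) oracle (fun k => W (time k)) S N).subgrads
                = N * S ∧
              objective f 0
                  (algOutput (algParams (ε / R ^ 2) χ N S) oracle (fun k => W (time k)) N S)
                - objective f 0 xstar ≤ ε := by
  refine ⟨500, by norm_num, fun M R ε χ hM hR hε hχ => ?_⟩
  have hb : 0 ≤ χ * M * R / ε := by positivity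
  have hq : 0 ≤ M ^ 2 * R ^ 2 / ε ^ 2 := by positivity
  set K : ℕ := ⌊40 * (χ * M * R / ε)⌋₊ + 1 with hK
  have hK1 : 1 ≤ K := by omega
  have hK0 : (0 : ℝ) < K := by positivity
  have hKle : (K : ℝ) ≤ 40 * (χ * M * R / ε) + 1 := by
    rw [hK]; push_cast
    linarith [Nat.floor_le (show 0 ≤ 40 * (χ * M * R / ε) by positivity)]
  have hKge : 40 * (χ * M * R / ε) ≤ K := by
    rw [hK]; push_cast
    exact (Nat.lt_floor_add_one _).le
  set T : ℕ := ⌊432 * (M ^ 2 * R ^ 2 / ε ^ 2) / K⌋₊ + 1 with hT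
  have hT1 : 1 ≤ T := by omega
  have hKTle : (K : ℝ) * T ≤ 432 * (M ^ 2 * R ^ 2 / ε ^ 2) + K := by
    have h : (T : ℝ) ≤ 432 * (M ^ 2 * R ^ 2 / ε ^ 2) / K + 1 := by
      rw [hT]; push_cast
      linarith [Nat.floor_le (show 0 ≤ 432 * (M ^ 2 * R ^ 2 / ε ^ 2) / K by positivity)]
    refine (mul_le_mul_of_nonneg_left h hK0.le).trans_eq ?_
    field_simp
  have hKTge : 432 * (M ^ 2 * R ^ 2 / ε ^ 2) ≤ K * T := by
    have h : 432 * (M ^ 2 * R ^ 2 / ε ^ 2) / K ≤ T := by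
      rw [hT]; push_cast
      exact (Nat.lt_floor_add_one _).le
    rw [div_le_iff₀ hK0] at h
    linarith
  refine ⟨K, T, hK1, hT1, by linarith, by linarith, fun hsmall => ?_, ?_⟩
  · -- here `χ ≤ M R / ε`, so the rounding terms are dominated
    have h1 : χ ≤ M * R / ε := by rwa [le_div_iff₀ hε]
    have e1 : χ * M * R / ε = χ * (M * R / ε) := by ring
    have e2 : M ^ 2 * R ^ 2 / ε ^ 2 = M * R / ε * (M * R / ε) := by field_simp
    have h2 : 1 ≤ χ * M * R / ε := by
      rw [e1]; exact one_le_mul_of_one_le_of_one_le hχ (hχ.trans h1)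
    have h3 : χ * M * R / ε ≤ M ^ 2 * R ^ 2 / ε ^ 2 := by
      rw [e1, e2]; exact mul_le_mul_of_nonneg_right h1 (by linarith)
    exact ⟨by linarith, by linarith⟩
  · intro n d hn f oracle xstar E W time _ hL ho _ hxs hW hcond N S hKN hKTNS
    refine ⟨algState_comms _ _ _ _ _, algState_subgrads _ _ _ _ _, ?_⟩
    have hN : 1 ≤ N := hK1.trans hKN
    have hS : 1 ≤ S := by
      by_contra! h
      have h1 : 1 ≤ K * T := Nat.mul_le_mul hK1 hT1
      rw [Nat.lt_one_iff.1 h, Nat.mul_zero] at hKTNS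
      omega
    have hN1 : (1 : ℝ) ≤ N := by exact_mod_cast hN
    have hS0 : (0 : ℝ) < S := by positivity
    have hr : 0 < ε / R ^ 2 := by positivity
    have hmain := objective_gap_le hn hr hχ hM hL ho (A := fun k => W (time k))
      (fun k => (hW (time k)).2.1) (fun k => (hW (time k)).2.2) (fun k => hcond (time k)) hxs hN hS
    set gap := objective f 0
        (algOutput (algParams (ε / R ^ 2) χ N S) oracle (fun k => W (time k)) N S)
      - objective f 0 xstar with hgap
    set q := M ^ 2 * R ^ 2 / ε ^ 2 with hq_def
    have e1 : ε / R ^ 2 / 2 * R ^ 2 = ε / 2 := by field_simp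
    have e2 : ε / R ^ 2 / 3 * R ^ 2 = ε / 3 := by field_simp
    have e3 : 21 * χ ^ 2 * M ^ 2 / (ε / R ^ 2) = 21 * ε * (χ ^ 2 * q) := by
      rw [hq_def]; field_simp
    have e4 : 6 * M ^ 2 * N / (ε / R ^ 2 * S) = 6 * ε * (q * N / S) := by
      rw [hq_def]; field_simp
    rw [e1, e2, e3, e4] at hmain
    have hKN' : (K : ℝ) ≤ N := by exact_mod_cast hKN
    have hχq : 1600 * (χ ^ 2 * q) ≤ (N : ℝ) ^ 2 := by
      have h := pow_le_pow_left₀ (by positivity) (hKge.trans hKN') 2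
      refine le_trans (le_of_eq ?_) h
      rw [hq_def]; field_simp; ring
    have hqNS : 432 * (q * N / S) ≤ (N : ℝ) ^ 2 := by
      have h : 432 * q ≤ (N : ℝ) * S := hKTge.trans (by exact_mod_cast hKTNS)
      rw [← mul_div_assoc, div_le_iff₀ hS0]
      nlinarith
    -- both error terms are at most `ε N² / 72`
    by_contra! hcon
    have hΛ : 0 ≤ (N : ℝ) * (N + 5) / 6 := by positivity
    have h1 : (N : ℝ) * (N + 5) / 6 * (ε / 2) ≤ N * (N + 5) / 6 * (gap - ε / 2) :=
      mul_le_mul_of_nonneg_left (by linarith) hΛ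
    have h2 := mul_le_mul_of_nonneg_left hχq hε.le
    have h3 := mul_le_mul_of_nonneg_left hqNS hε.le
    have h4 : ε * 1 ≤ ε * (N : ℝ) := mul_le_mul_of_nonneg_left hN1 hε.le
    have h5 : ε * (N : ℝ) ≤ ε * (N : ℝ) ^ 2 := by gcongr; nlinarith
    linarith
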